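/- Let $p$ be a prime and $R$ a commutative ring in which $p$ is nilpotent. Let $W(R)$ be its ring of $p$-typical Witt vectors, with Frobenius $F$, augmentation ideal $I_R=\ker(W(R)\to R)$ and $F^{\mathrm{div}}\colon I_R\to W(R)$ the inverse of the Verschiebung. For a $W(R)$-module $M$ write $M^F=W(R)\otimes_{F,W(R)}M$. A \emph{display} $\mathcal P=(T,L,\Psi)$ over $R$ consists of finite projective $W(R)$-modules $T,L$ and a $W(R)$-linear isomorphism $\Psi\colon T^F\oplus L^F\to T\oplus L$; it has dimension $\operatorname{rk}T$ and height $\operatorname{rk}T+\operatorname{rk}L$. A \emph{morphism} $\mathcal P\to\mathcal P'$ is a block matrix $\begin{pmatrix}a&b\\c&d\end{pmatrix}$ of $W(R)$-linear maps $a\colon T\to T'$, $b\colon L\to I_R\otimes_{W(R)}T'$, $c\colon T\to L'$, $d\colon L\to L'$ with $$\begin{pmatrix}a&b\\c&d\end{pmatrix}\circ\Psi=\Psi'\circ\begin{pmatrix}a^F&b^{F,\mathrm{div}}\\p\,c^F&d^F\end{pmatrix},$$ where $b^{F,\mathrm{div}}\colon L^F\to T'^F$ is the linearization of $b$ followed by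 $x\otimes t\mapsto F^{\mathrm{div}}(x)\otimes t$. Let $\breve z\colon L\to L^F$ be the lower right block of $\Psi^{-1}$; $\mathcal P$ is \emph{nilpotent} if for some $e\ge0$ the composition $\breve z^{(p^{e-1})}\circ\cdots\circ\breve z\colon R/pR\otimes_{W(R)}L\to(R/pR\otimes_{W(R)}L)^{(p^e)}$ vanishes. The \emph{iso-display} $\mathcal P[1/p]$ is the $W(R)[1/p]$-module $(T\oplus L)[1/p]$ with the $F$-linear map induced by $(t,l)\mapsto\Psi(1\otimes t,\;p\otimes l)$; morphisms of iso-displays are the $W(R)[1/p]$-linear maps commuting with these $F$-linear maps. A \emph{quasi-isogeny} $\mathcal P\dashrightarrow\mathcal P'$ is an isomorphism $\mathcal P[1/p]\to\mathcal P'[1/p]$ of iso-displays. A morphism $f\colon\mathcal P\to\mathcal P'$ between displays of the same constant height and dimension is an \emph{isogeny} if it induces an isomorphism $\mathcal P[1/p]\to\mathcal P'[1/p]$. It has \emph{height} $m$ if $\nu_p(\det f)=m$ at every point of $\operatorname{Spec}R$; here, for $x\in\operatorname{Spec}R$ and $k$ an algebraic closure of the residue field at $x$, $\nu_p(\det f)(x)$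 is the $p$-adic valuation of the determinant of the base change of $f$ to $W(k)$ (equivalently, of $\det f$ as a morphism of rank one $\mathbb Z_p$-local systems on $\operatorname{Spec}R$). A quasi-isogeny $\mathcal P\dashrightarrow\mathcal P'$ is said to be an isogeny if it is induced by an isogeny of displays $\mathcal P\to\mathcal P'$. \textbf{Statement.} Let $f\colon\mathcal P\to\mathcal P'$ be an isogeny of height $m$ (a non-negative integer) between nilpotent displays over $R$. Then the quasi-isogeny $$p^m\cdot f^{-1}\colon\mathcal P'\dashrightarrow\mathcal P$$ is an isogeny, i.e. it is induced by an isogeny of displays $\mathcal P'\to\mathcal P$. -/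

import Mathlib

open scoped TensorProduct

universe u v

namespace WittDisplay

noncomputable section

/-! ### Base change of modules along an arbitrary ring homomorphism -/

section BaseChange

/-- The ring `B`, regarded as an `A`-algebra via `f : A → B`. (A type synonym, so that endomorphisms
such as the Frobenius can be used without clashing with the tautological algebra structure.) -/
def AlongHom {A B : Type*} [CommRing A] [CommRing B] (_f : A →+* B) : Type _ := B

instance {A B : Type*} [CommRing A] [CommRing B] (f : A →+* B) : CommRing (AlongHom f) :=
  inferInstanceAs (CommRing B)

instance {A B : Type*} [CommRing A] [CommRing B] (f : A →+* B) : Algebra A (AlongHom f) :=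
  f.toAlgebra

/-- The base change `B ⊗_{f, A} M` of an `A`-module `M` along `f : A → B`. -/
def BaseChange {A B : Type*} [CommRing A] [CommRing B] (f : A →+* B)
    (M : Type*) [AddCommGroup M] [Module A M] : Type _ :=
  AlongHom f ⊗[A] M

variable {A B C : Type*} [CommRing A] [CommRing B] [CommRing C] (f : A →+* B)
variable (M : Type*) [AddCommGroup M] [Module A M]

instance : AddCommGroup (BaseChange f M) :=
  inferInstanceAs (AddCommGroup (AlongHom f ⊗[A] M))

/-- The `B`-module structure, acting on the first tensor factor. -/
instance : Module B (BaseChange f M) :=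
  inferInstanceAs (Module (AlongHom f) (AlongHom f ⊗[A] M))

namespace BaseChange

variable {M} {N : Type*} [AddCommGroup N]

/-- The pure tensor `b ⊗ x` in `B ⊗_{f, A} M`. -/
def tmul (b : B) (x : M) : BaseChange f M := TensorProduct.tmul A (show AlongHom f from b) x

theorem smul_tmul (b c : B) (x : M) : b • tmul f c x = tmul f (b * c) x := rfl

theorem tmul_smul (b : B) (a : A) (x : M) : tmul f b (a • x) = tmul f (f a * b) x :=
  (TensorProduct.smul_tmul (R := A) a (show AlongHom f from b) x).symm

theorem induction {P : BaseChange f M → Prop} (z : BaseChange f M) (zero : P 0)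
    (tmul : ∀ b x, P (tmul f b x)) (add : ∀ x y, P x → P y → P (x + y)) : P z :=
  TensorProduct.induction_on z zero tmul add

/-- The canonical `f`-linear map `x ↦ 1 ⊗ x`. -/
def mk : M →ₛₗ[f] BaseChange f M where
  toFun x := tmul f 1 x
  map_add' x y := TensorProduct.tmul_add (R := A) (1 : AlongHom f) x y
  map_smul' a x := by rw [tmul_smul, smul_tmul]

/-- Given `h = g ∘ f` and an `h`-linear map `φ : M → N`, the induced `g`-linear map
`B ⊗_{f, A} M → N`, `b ⊗ x ↦ g(b) φ(x)`. For `g = id` this is the linearization of `φ`. -/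
def lift (g : B →+* C) (h : A →+* C) (H : g.comp f = h) [Module C N] (φ : M →ₛₗ[h] N) :
    BaseChange f M →ₛₗ[g] N :=
  let θ : AlongHom f ⊗[A] M →ₛₗ[h] N := TensorProduct.lift
    { toFun := fun b => g b • φ
      map_add' := fun b c => by
        have e : g (b + c : AlongHom f) = g b + g c := map_add g (b : B) c
        rw [e, add_smul]
      map_smul' := fun a b => by
        have e : g (a • b : AlongHom f) = h a * g b := by
          rw [← H]; exact map_mul g (f a) (b : B)
        rw [e, mul_smul] }
  { toFun := θ
    map_add' := θ.map_add
    map_smul' := fun b z => by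
      refine induction f (P := fun z => θ (b • z) = g b • θ z) z ?_ ?_ ?_
      · rw [smul_zero]; exact θ.map_zero.trans (smul_zero _).symm
      · intro c x
        change g (b * c) • φ x = g b • g c • φ x
        rw [map_mul, mul_smul]
      · intro x y hx hy
        rw [smul_add]
        exact (θ.map_add _ _).trans ((congrArg₂ (· + ·) hx hy).trans
          ((smul_add _ _ _).symm.trans (congrArg _ (θ.map_add _ _).symm))) }

theorem lift_tmul (g : B →+* C) (h : A →+* C) (H : g.comp f = h) [Module C N] (φ : M →ₛₗ[h] N)
    (b : B) (x : M) : lift f g h H φ (tmul f b x) = g b • φ x := rfl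

/-- The linearization `B ⊗_{f, A} M → N` of an `f`-linear map `M → N`. -/
def linearize [Module B N] (φ : M →ₛₗ[f] N) : BaseChange f M →ₗ[B] N :=
  lift f (RingHom.id B) f (RingHom.id_comp f) φ

/-- The base change of an `A`-linear map along `f`. -/
def map [Module A N] (φ : M →ₗ[A] N) : BaseChange f M →ₗ[B] BaseChange f N :=
  linearize f ((mk f).comp φ)

/-- The base change of a semilinear map: if `τ ∘ f = f ∘ σ`, a `σ`-linear map `φ : M → N` induces the
`τ`-linear map `b ⊗ x ↦ τ(b) ⊗ φ(x)`. -/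
def mapSemilinear [Module A N] (σ : A →+* A) (τ : B →+* B) (H : τ.comp f = f.comp σ)
    (φ : M →ₛₗ[σ] N) : BaseChange f M →ₛₗ[τ] BaseChange f N :=
  haveI : RingHomCompTriple σ f (f.comp σ) := ⟨rfl⟩
  lift f τ (f.comp σ) H ((mk f).comp φ)

theorem linearize_mk [Module B N] (φ : M →ₛₗ[f] N) (x : M) : linearize f φ (mk f x) = φ x :=
  one_smul B (φ x)

theorem map_tmul [Module A N] (φ : M →ₗ[A] N) (b : B) (x : M) :
    map f φ (tmul f b x) = tmul f b (φ x) := by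
  change tmul f (b * 1) (φ x) = _
  rw [mul_one]

theorem mapSemilinear_tmul [Module A N] (σ : A →+* A) (τ : B →+* B) (H : τ.comp f = f.comp σ)
    (φ : M →ₛₗ[σ] N) (b : B) (x : M) :
    mapSemilinear f σ τ H φ (tmul f b x) = tmul f (τ b) (φ x) := by
  change tmul f (τ b * 1) (φ x) = _
  rw [mul_one]

theorem map_mapSemilinear [Module A N] (σ : A →+* A) (τ : B →+* B) (H : τ.comp f = f.comp σ)
    (φ : M →ₛₗ[σ] M) (ψ : N →ₛₗ[σ] N) (α : M →ₗ[A] N) (h : ∀ x, α (φ x) = ψ (α x))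
    (z : BaseChange f M) :
    map f α (mapSemilinear f σ τ H φ z) = mapSemilinear f σ τ H ψ (map f α z) := by
  induction z using BaseChange.induction with
  | zero => simp only [map_zero]
  | tmul b x => rw [mapSemilinear_tmul, map_tmul, map_tmul, mapSemilinear_tmul, h]
  | add x y hx hy => simp only [map_add, hx, hy]

/-- The canonical `g`-linear map `B ⊗_{f, A} M → C ⊗_{g ∘ f, A} M`, `b ⊗ x ↦ g(b) ⊗ x`. -/
def push (g : B →+* C) : BaseChange f M →ₛₗ[g] BaseChange (g.comp f) M :=
  lift f g (g.comp f) rfl (mk (g.comp f))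

end BaseChange

end BaseChange

/-! ### The Witt frame -/

section Frame

variable (p : ℕ) [Fact p.Prime] (R : Type u) [CommRing R]

/-- The Frobenius `F : W(R) → W(R)`. -/
abbrev F : WittVector p R →+* WittVector p R := WittVector.frobenius

/-- The augmentation ideal `I_R = ker (W(R) → R)`. -/
abbrev augIdeal : Ideal (WittVector p R) := RingHom.ker (WittVector.constantCoeff (p := p) (R := R))

variable {p R}

theorem verschiebung_shift_one (x : augIdeal p R) :
    WittVector.verschiebung ((x : WittVector p R).shift 1) = x := by
  have h : ∀ i < 0 + 1, (x : WittVector p R).coeff i = 0 := by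
    intro i hi
    obtain rfl : i = 0 := by omega
    exact x.2
  have := WittVector.verschiebung_shift (x : WittVector p R) 0 h
  rw [this]
  ext n
  simp [WittVector.shift_coeff]

variable (p R)

/-- The inverse `F^div : I_R → W(R)` of the Verschiebung `V : W(R) ≃ I_R`; it is `F`-linear. -/
def Fdiv : augIdeal p R →ₛₗ[F p R] WittVector p R where
  toFun x := (x : WittVector p R).shift 1
  map_add' x y := by
    apply WittVector.verschiebung_injective
    rw [map_add, verschiebung_shift_one, verschiebung_shift_one, verschiebung_shift_one]
    rfl
  map_smul' a x := by
    apply WittVector.verschiebung_injective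
    rw [verschiebung_shift_one, smul_eq_mul, mul_comm, WittVector.verschiebung_mul_frobenius,
      verschiebung_shift_one, Submodule.coe_smul, smul_eq_mul, mul_comm]

theorem verschiebung_Fdiv (x : augIdeal p R) : WittVector.verschiebung (Fdiv p R x) = x :=
  verschiebung_shift_one x

/-- The defining identity `p · F^div = F` of a frame. -/
theorem p_mul_Fdiv (x : augIdeal p R) : (p : WittVector p R) * Fdiv p R x = F p R x := by
  rw [mul_comm, ← WittVector.frobenius_verschiebung, verschiebung_Fdiv]

variable {p R}
variable {N N' : Type*} [AddCommGroup N] [Module (WittVector p R) N]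
  [AddCommGroup N'] [Module (WittVector p R) N']

/-- The multiplication map `I_R ⊗ N → N`. -/
def augMul : augIdeal p R ⊗[WittVector p R] N →ₗ[WittVector p R] N :=
  TensorProduct.lift ((LinearMap.lsmul (WittVector p R) N).comp (augIdeal p R).subtype)

/-- The `F`-linear map `I_R ⊗ N → N^F`, `x ⊗ n ↦ F^div(x) ⊗ n`. -/
def FdivTensor : augIdeal p R ⊗[WittVector p R] N →ₛₗ[F p R] BaseChange (F p R) N :=
  TensorProduct.lift
    { toFun := fun x => Fdiv p R x • BaseChange.mk (F p R)
      map_add' := fun x y => by rw [map_add, add_smul]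
      map_smul' := fun a x => by rw [map_smulₛₗ, smul_eq_mul, mul_smul] }

/-- For `b : N → I_R ⊗ N'`, the map `b^{F,div} : N^F → N'^F`, i.e. `b^F : N^F → I_R^F ⊗ N'^F` followed by
the linearization of `F^div`. -/
def twistDiv (b : N →ₗ[WittVector p R] augIdeal p R ⊗[WittVector p R] N') :
    BaseChange (F p R) N →ₗ[WittVector p R] BaseChange (F p R) N' :=
  BaseChange.linearize (F p R) (FdivTensor.comp b)

end Frame

/-! ### Displays -/

/-- A (not necessarily nilpotent) display over `R`, i.e. a window over the Witt frame
`(W(R), I_R, W(R), F, F^div)`: finite projective `W(R)`-modules `T`, `L` and an isomorphism of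
`W(R)`-modules `Ψ : T^F ⊕ L^F ≃ T ⊕ L`. -/
structure Display (p : ℕ) [Fact p.Prime] (R : Type u) [CommRing R] where
  T : Type v
  L : Type v
  [addCommGroupT : AddCommGroup T]
  [addCommGroupL : AddCommGroup L]
  [moduleT : Module (WittVector p R) T]
  [moduleL : Module (WittVector p R) L]
  [finiteT : Module.Finite (WittVector p R) T]
  [finiteL : Module.Finite (WittVector p R) L]
  [projectiveT : Module.Projective (WittVector p R) T]
  [projectiveL : Module.Projective (WittVector p R) L]
  Ψ : (BaseChange (F p R) T × BaseChange (F p R) L) ≃ₗ[WittVector p R] (T × L)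

namespace Display

attribute [instance] addCommGroupT addCommGroupL moduleT moduleL finiteT finiteL
  projectiveT projectiveL

variable {p : ℕ} [Fact p.Prime] {R : Type u} [CommRing R]

/-- The underlying finite projective `W(R)`-module `T ⊕ L`. -/
abbrev Carrier (P : Display.{u, v} p R) : Type v := P.T × P.L

/-- `P` has (constant) dimension `d` and codimension `c`, so height `d + c`. -/
def HasRank (P : Display.{u, v} p R) (d c : ℕ) : Prop :=
  (∀ x : PrimeSpectrum (WittVector p R), Module.rankAtStalk P.T x = d) ∧
    (∀ x : PrimeSpectrum (WittVector p R), Module.rankAtStalk P.L x = c)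

/-! #### Nilpotence -/

/-- The lower right block `z̆ : L → L^F` of `Ψ⁻¹ : T ⊕ L → T^F ⊕ L^F`. -/
def zBreve (P : Display.{u, v} p R) : P.L →ₗ[WittVector p R] BaseChange (F p R) P.L :=
  (LinearMap.snd _ _ _).comp (P.Ψ.symm.toLinearMap.comp (LinearMap.inr _ _ _))

variable (p R) in
/-- The iterated Frobenius `F^e`. -/
def frobIter : ℕ → (WittVector p R →+* WittVector p R)
  | 0 => RingHom.id _
  | e + 1 => (F p R).comp (frobIter e)

/-- The composition `z̆^{F^{e-1}} ∘ ⋯ ∘ z̆^F ∘ z̆ : L → L^{F^e}`. -/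
def zBreveIter (P : Display.{u, v} p R) :
    (e : ℕ) → P.L →ₗ[WittVector p R] BaseChange (frobIter p R e) P.L
  | 0 => BaseChange.mk (RingHom.id _)
  | e + 1 =>
    (BaseChange.linearize (F p R)
      ((BaseChange.push (frobIter p R e) (F p R)).comp (P.zBreveIter e))).comp P.zBreve

variable (p R) in
/-- The projection `W(R) → R → R/pR`. -/
def toModP : WittVector p R →+* R ⧸ Ideal.span {(p : R)} :=
  (Ideal.Quotient.mk _).comp WittVector.constantCoeff

/-- `P` is nilpotent of nilpotence order `≤ e`: the composition
`z̆^{(p^{e-1})} ∘ ⋯ ∘ z̆ : R/pR ⊗ L → R/pR ⊗ L^{F^e} = (R/pR ⊗ L)^{(p^e)}` vanishes. -/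
def IsNilpotentOfOrder (P : Display.{u, v} p R) (e : ℕ) : Prop :=
  BaseChange.map (toModP p R) (P.zBreveIter e) = 0

/-- `P` is nilpotent (of some nilpotence order). -/
def IsNilpotent (P : Display.{u, v} p R) : Prop := ∃ e : ℕ, P.IsNilpotentOfOrder e

/-! #### Morphisms of displays -/

/-- A morphism of displays: a block matrix `[a b; c d]` with `a : T → T'`, `b : L → I_R ⊗ T'`,
`c : T → L'`, `d : L → L'` such that
`Ψ' ∘ [a^F b^{F,div}; p·c^F d^F] = [a b; c d] ∘ Ψ`. -/
structure Hom (P P' : Display.{u, v} p R) where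
  a : P.T →ₗ[WittVector p R] P'.T
  b : P.L →ₗ[WittVector p R] augIdeal p R ⊗[WittVector p R] P'.T
  c : P.T →ₗ[WittVector p R] P'.L
  d : P.L →ₗ[WittVector p R] P'.L
  comm : ∀ (t : BaseChange (F p R) P.T) (l : BaseChange (F p R) P.L),
    P'.Ψ (BaseChange.map (F p R) a t + twistDiv b l,
        (p : WittVector p R) • BaseChange.map (F p R) c t + BaseChange.map (F p R) d l) =
      (a (P.Ψ (t, l)).1 + augMul (b (P.Ψ (t, l)).2), c (P.Ψ (t, l)).1 + d (P.Ψ (t, l)).2)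

/-- The underlying `W(R)`-linear map `T ⊕ L → T' ⊕ L'` of a morphism of displays. -/
def Hom.toLinearMap {P P' : Display.{u, v} p R} (f : P.Hom P') :
    P.Carrier →ₗ[WittVector p R] P'.Carrier :=
  (f.a.coprod (augMul.comp f.b)).prod (f.c.coprod f.d)

/-! #### Iso-displays -/

variable (p R) in
/-- The ring `W(R)[1/p]`. -/
abbrev WQ : Type u := Localization.Away (p : WittVector p R)

variable (p R) in
/-- The Frobenius of `W(R)[1/p]`. -/
def FQ : WQ p R →+* WQ p R :=
  IsLocalization.map (M := Submonoid.powers (p : WittVector p R))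
    (T := Submonoid.powers (p : WittVector p R)) (WQ p R) (F p R) (by
      rintro _ ⟨n, rfl⟩
      exact ⟨n, by simp⟩)

variable (p R) in
theorem FQ_comp : (FQ p R).comp (algebraMap (WittVector p R) (WQ p R)) =
    (algebraMap (WittVector p R) (WQ p R)).comp (F p R) :=
  IsLocalization.map_comp _

/-- The Frobenius `T ⊕ L → T ⊕ L` of a display: the `F`-linear map `(t, l) ↦ Ψ(1 ⊗ t, p ⊗ l)`. -/
def frob (P : Display.{u, v} p R) : P.Carrier →ₛₗ[F p R] P.Carrier where
  toFun x := P.Ψ (BaseChange.mk (F p R) x.1, (p : WittVector p R) • BaseChange.mk (F p R) x.2)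
  map_add' x y := by
    rw [← P.Ψ.map_add]
    congr 1
    ext1
    · exact (BaseChange.mk (F p R)).map_add x.1 y.1
    · exact (congrArg _ ((BaseChange.mk (F p R)).map_add x.2 y.2)).trans (smul_add _ _ _)
  map_smul' r x := by
    rw [← P.Ψ.map_smul]
    congr 1
    ext1
    · exact (BaseChange.mk (F p R)).map_smulₛₗ r x.1
    · exact (congrArg _ ((BaseChange.mk (F p R)).map_smulₛₗ r x.2)).trans (smul_comm _ _ _)

/-- The underlying `W(R)[1/p]`-module of the iso-display `P[1/p]`. -/
abbrev Iso (P : Display.{u, v} p R) : Type (max u v) :=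
  BaseChange (algebraMap (WittVector p R) (WQ p R)) P.Carrier

/-- The Frobenius of the iso-display `P[1/p]`. -/
def isoFrob (P : Display.{u, v} p R) : P.Iso →ₛₗ[FQ p R] P.Iso :=
  BaseChange.mapSemilinear _ (F p R) (FQ p R) (FQ_comp p R) P.frob

/-- A morphism of displays up to isogeny `P ⇢ P'`, i.e. a morphism of iso-displays
`P[1/p] → P'[1/p]`: a `W(R)[1/p]`-linear map commuting with the Frobenius maps. -/
def QuasiHom (P P' : Display.{u, v} p R) : Type (max u v) :=
  { φ : P.Iso →ₗ[WQ p R] P'.Iso // ∀ x, φ (P.isoFrob x) = P'.isoFrob (φ x) }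

/-- A quasi-isogeny `P ⇢ P'`, i.e. an isomorphism of iso-displays `P[1/p] → P'[1/p]`. -/
def QuasiIsogeny (P P' : Display.{u, v} p R) : Type (max u v) :=
  { φ : P.Iso ≃ₗ[WQ p R] P'.Iso // ∀ x, φ (P.isoFrob x) = P'.isoFrob (φ x) }

namespace QuasiIsogeny

variable {P P' : Display.{u, v} p R}

/-- The morphism of iso-displays underlying a quasi-isogeny. -/
def toQuasiHom (φ : QuasiIsogeny P P') : QuasiHom P P' := ⟨φ.1.toLinearMap, φ.2⟩

/-- The inverse `φ⁻¹ : P' ⇢ P` of a quasi-isogeny `φ : P ⇢ P'`. -/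
def symm (φ : QuasiIsogeny P P') : QuasiIsogeny P' P :=
  ⟨φ.1.symm, fun x => by
    apply φ.1.injective
    rw [φ.2, LinearEquiv.apply_symm_apply, LinearEquiv.apply_symm_apply]⟩

variable (p R) in
/-- `p` as a unit of `W(R)[1/p]`. -/
def pUnit : (WQ p R)ˣ :=
  (IsLocalization.Away.algebraMap_isUnit (S := WQ p R) (p : WittVector p R)).unit

variable (p R) in
theorem pUnit_val : ((pUnit p R : (WQ p R)ˣ) : WQ p R) = (p : WQ p R) :=
  map_natCast (algebraMap (WittVector p R) (WQ p R)) p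

variable (p R) in
theorem FQ_pUnit_pow (m : ℕ) :
    FQ p R (((pUnit p R) ^ m : (WQ p R)ˣ) : WQ p R) = (((pUnit p R) ^ m : (WQ p R)ˣ) : WQ p R) := by
  rw [Units.val_pow_eq_pow_val, pUnit_val, map_pow, map_natCast]

/-- The quasi-isogeny `p^m · φ : P ⇢ P'` for a quasi-isogeny `φ : P ⇢ P'`. -/
def pPowSMul (m : ℕ) (φ : QuasiIsogeny P P') : QuasiIsogeny P P' :=
  ⟨φ.1.trans (LinearEquiv.smulOfUnit ((pUnit p R) ^ m)), fun x => by
    change (((pUnit p R) ^ m : (WQ p R)ˣ) : WQ p R) • φ.1 (P.isoFrob x) =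
      P'.isoFrob ((((pUnit p R) ^ m : (WQ p R)ˣ) : WQ p R) • φ.1 x)
    rw [LinearMap.map_smulₛₗ, FQ_pUnit_pow, φ.2]⟩

theorem pPowSMul_apply (m : ℕ) (φ : QuasiIsogeny P P') (x : P.Iso) :
    (pPowSMul m φ).1 x = (p ^ m : WQ p R) • φ.1 x := by
  change (((pUnit p R) ^ m : (WQ p R)ˣ) : WQ p R) • φ.1 x = _
  rw [Units.val_pow_eq_pow_val, pUnit_val]

end QuasiIsogeny

namespace Hom

variable {P P' : Display.{u, v} p R} (f : P.Hom P')

theorem p_smul_FdivTensor {N : Type*} [AddCommGroup N] [Module (WittVector p R) N]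
    (z : augIdeal p R ⊗[WittVector p R] N) :
    (p : WittVector p R) • FdivTensor z = BaseChange.mk (F p R) (augMul z) := by
  induction z with
  | zero => rw [map_zero, map_zero, map_zero, smul_zero]
  | add x y hx hy => rw [map_add, smul_add, hx, hy, map_add, map_add]
  | tmul x n =>
    change (p : WittVector p R) • Fdiv p R x • BaseChange.mk (F p R) n =
      BaseChange.mk (F p R) ((x : WittVector p R) • n)
    rw [LinearMap.map_smulₛₗ, ← p_mul_Fdiv, mul_smul]

/-- The underlying linear map of a morphism of displays commutes with the Frobenius maps. -/
theorem toLinearMap_frob (x : P.Carrier) :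
    f.toLinearMap (P.frob x) = P'.frob (f.toLinearMap x) := by
  obtain ⟨t, l⟩ := x
  refine (f.comm (BaseChange.mk (F p R) t)
    ((p : WittVector p R) • BaseChange.mk (F p R) l)).symm.trans ?_
  change P'.Ψ _ = P'.Ψ (BaseChange.mk (F p R) (f.a t + augMul (f.b l)),
    (p : WittVector p R) • BaseChange.mk (F p R) (f.c t + f.d l))
  congr 1
  rw [LinearMap.map_smul, LinearMap.map_smul, ← smul_add, map_add, map_add]
  simp only [BaseChange.map, twistDiv]
  rw [BaseChange.linearize_mk, BaseChange.linearize_mk, BaseChange.linearize_mk,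
    BaseChange.linearize_mk, ← p_smul_FdivTensor]
  rfl

/-- The morphism of iso-displays `P[1/p] → P'[1/p]` induced by a morphism of displays. -/
def toQuasiHom : QuasiHom P P' :=
  ⟨BaseChange.map (algebraMap (WittVector p R) (WQ p R)) f.toLinearMap,
    BaseChange.map_mapSemilinear _ _ _ _ _ _ _ f.toLinearMap_frob⟩

/-- `f` is an isogeny: `P` and `P'` have the same constant height and dimension, and `f` induces an
isomorphism of iso-displays `P[1/p] → P'[1/p]`. -/
structure IsIsogeny : Prop where
  hasRank : ∃ d c : ℕ, P.HasRank d c ∧ P'.HasRank d c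
  exists_eq : ∃ φ : QuasiIsogeny P P', φ.toQuasiHom = f.toQuasiHom

variable {f} in
/-- An isogeny, regarded as a quasi-isogeny `P ⇢ P'`. -/
def IsIsogeny.quasiIsogeny (hf : f.IsIsogeny) : QuasiIsogeny P P' := hf.exists_eq.choose

variable {f} in
theorem IsIsogeny.quasiIsogeny_toQuasiHom (hf : f.IsIsogeny) :
    hf.quasiIsogeny.toQuasiHom = f.toQuasiHom := hf.exists_eq.choose_spec

/-! #### The height of an isogeny -/

/-- The ring homomorphism from `R` to an algebraic closure of the residue field at `x ∈ Spec R`. -/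
def toGeomPoint (x : PrimeSpectrum R) : R →+* AlgebraicClosure x.asIdeal.ResidueField :=
  (algebraMap x.asIdeal.ResidueField _).comp (algebraMap R x.asIdeal.ResidueField)

/-- The base change `f_x` of (the linear map underlying) `f` along `W(R) → W(k)`, with `k` an
algebraic closure of the residue field at `x`. -/
def atPoint (x : PrimeSpectrum R) :
    BaseChange (WittVector.map (p := p) (toGeomPoint x)) P.Carrier
      →ₗ[WittVector p (AlgebraicClosure x.asIdeal.ResidueField)]
    BaseChange (WittVector.map (p := p) (toGeomPoint x)) P'.Carrier :=
  BaseChange.map _ f.toLinearMap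

/-- The function `ν_p(det f) : |Spec R| → ℕ ∪ {∞}`: at `x` it is the largest `n` such that the map
`det f_x` (the top exterior power of `f_x`) between the invertible `W(k)`-modules `det P_x`, `det P'_x`
is divisible by `p^n`. As `det P_x = W(k) ⊗ 𝕃_x`, where `𝕃_x` is the free `ℤ_p`-module of rank one of
Frobenius invariants, i.e. the stalk at `x` of the `ℤ_p`-local system attached to `det P` (and
likewise for `P'`), this is the `p`-adic valuation of `det f` as a morphism of local systems. -/
def nuDet (x : PrimeSpectrum R) : ℕ∞ :=
  let Wk := WittVector p (AlgebraicClosure x.asIdeal.ResidueField)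
  let h := Module.finrank Wk (BaseChange (WittVector.map (p := p) (toGeomPoint x)) P.Carrier)
  ⨆ (n : ℕ) (_ : ∀ ω, ∃ η, exteriorPower.map h (f.atPoint x) ω = (p ^ n : Wk) • η), (n : ℕ∞)

/-- `f` has height `m`: the function `ν_p(det f)` is constant with value `m`. -/
def HasHeight (m : ℕ) : Prop := ∀ x : PrimeSpectrum R, f.nuDet x = m

end Hom

/-- A quasi-isogeny `φ : P ⇢ P'` is an isogeny if it is induced by an isogeny of displays `P → P'`. -/
def QuasiIsogeny.IsIsogeny {P P' : Display.{u, v} p R} (φ : QuasiIsogeny P P') : Prop :=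
  ∃ g : P.Hom P', g.IsIsogeny ∧ g.toQuasiHom = φ.toQuasiHom

end Display

end

end WittDisplay

namespace WittDisplay

open WittVector Display

/-! ### Frobenius-semilinear equations over Witt vectors -/

section WittVectors

variable {p : ℕ} [hp : Fact p.Prime] {R : Type*} [CommRing R]

/-! Were all modules free, one would take `g = u⁻¹ · adj(f)`, where `det f = p ^ m · u`: then `g ∘ f
= p ^ m`. It must be shown that `p ^ m` divides `det f`, that the quotient is a unit, and that `g`
respects the display structure.

The modules are only projective, and localizations of `W(R)` carry no Frobenius in general. So `det
f` is replaced by the vector `δ` of minors of `f` with respect to generators of the modules. Since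
`f` commutes with `Ψ`, it satisfies a global equation `δ = C F(δ)` (`MatrixWindow.IsHom.minors_eq`),
which in local bases says that `det f` equals a unit times its Frobenius twist.

Divisibility (`exists_eq_pow_smul`): at geometric points `p ^ m` divides `δ`, so the first `m` Witt
components of `δ` are nilpotent. In characteristic `p` a power of `F` kills them; iterating the
equation gives `δ = V^m z`, and iterating it again brings in `F^m V^m = p ^ m`. For nilpotent `p`
one uses that a power of `F` factors through `W(R/p)`. Thus `δ = p ^ m u` with `u = C F(u)`.

Unit: since the height is exactly `m`, the leading components of `u` generate `R`, so a high
Frobenius power of some combination of the `u k` is a unit. The equation for `u` shows that where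
`u` vanishes, so do all `F^n(u)`; hence the `u k` generate the unit ideal.

A relation `∑ η k * u k = 1` then gives a global matrix `MatrixWindow.adj` which locally is `u⁻¹
adj(f)` (`MatrixWindow.IsHom.adj_comm_and_adj_mul`). It defines a morphism of displays because
adjugates commute with the divided Frobenius twist (`IsTwist.det_and_adjugate`). -/

theorem map_frobenius {S : Type*} [CommRing S] (f : R →+* S) (x : WittVector p R) :
    WittVector.map f (frobenius x) = frobenius (WittVector.map f x) := by
  ext n
  rw [map_coeff, coeff_frobenius, coeff_frobenius, MvPolynomial.map_aeval, MvPolynomial.aeval_def,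
    MvPolynomial.coe_eval₂Hom]
  congr 1
  exact Subsingleton.elim _ _

theorem frobIter_succ_apply (n : ℕ) (x : WittVector p R) :
    frobIter p R (n + 1) x = frobenius (frobIter p R n x) := rfl

theorem frobIter_frobenius (n : ℕ) (x : WittVector p R) :
    frobIter p R n (frobenius x) = frobenius (frobIter p R n x) := by
  induction n with
  | zero => rfl
  | succ n ih => rw [frobIter_succ_apply, ih, frobIter_succ_apply]

theorem frobIter_eq_iterate (n : ℕ) (x : WittVector p R) :
    frobIter p R n x = (frobenius)^[n] x := by
  induction n with
  | zero => rfl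
  | succ n ih => rw [frobIter_succ_apply, ih, Function.iterate_succ_apply']

theorem frobIter_iterate_verschiebung (n : ℕ) (x : WittVector p R) :
    frobIter p R n (verschiebung^[n] x) = (p : WittVector p R) ^ n * x := by
  induction n with
  | zero => simp [frobIter]
  | succ n ih =>
    rw [Function.iterate_succ_apply', ← map_natCast (frobenius (p := p) (R := R))] at *
    rw [frobIter_succ_apply, ← frobIter_frobenius, frobenius_verschiebung, map_mul, ih]
    simp only [map_natCast]
    ring

/-- A polynomial without constant term takes multiples of `a` to multiples of `a`. -/
theorem dvd_aeval_of_constantCoeff_eq_zero {σ : Type*} (f : MvPolynomial σ ℤ)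
    (hf : MvPolynomial.constantCoeff f = 0) (a : R) (x : σ → R) (hx : ∀ i, a ∣ x i) :
    a ∣ MvPolynomial.aeval x f := by
  rw [← Ideal.mem_span_singleton, ← Ideal.Quotient.eq_zero_iff_mem]
  have hx' : ∀ i, Ideal.Quotient.mk (Ideal.span {a}) (x i) = 0 := fun i => by
    rw [Ideal.Quotient.eq_zero_iff_mem, Ideal.mem_span_singleton]; exact hx i
  rw [MvPolynomial.map_aeval]
  simp only [hx']
  have := MvPolynomial.eval₂Hom_zero'_apply
    ((Ideal.Quotient.mk (Ideal.span {a})).comp (algebraMap ℤ R)) f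
  rw [hf, map_zero] at this
  exact this

/-- Evaluate `F(0) = 0` over `ℤ`: the `n`-th component is `p` times the constant term. -/
theorem constantCoeff_frobeniusPolyAux (n : ℕ) :
    MvPolynomial.constantCoeff (frobeniusPolyAux p n) = 0 := by
  have h := coeff_frobenius (0 : WittVector p ℤ) n
  rw [map_zero, zero_coeff, frobeniusPoly, map_add, map_mul, map_pow, MvPolynomial.aeval_X,
    zero_coeff, zero_pow hp.out.ne_zero, zero_add, MvPolynomial.aeval_C] at h
  have h0 : (0 : WittVector p ℤ).coeff = 0 := by ext i; exact zero_coeff p ℤ i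
  rw [h0, MvPolynomial.aeval_zero] at h
  simpa [hp.out.ne_zero] using h

/-- The components of `F x` are `x_n ^ p` plus `p` times a polynomial without constant term. The
second part gains one factor `p`; the first does because `k * p ≥ k + 1` for `k ≥ 1`. -/
theorem pow_dvd_coeff_frobenius (k : ℕ) (hk : k ≠ 0) (x : WittVector p R)
    (hx : ∀ n, (p : R) ^ k ∣ x.coeff n) (n : ℕ) :
    (p : R) ^ (k + 1) ∣ (frobenius x).coeff n := by
  rw [coeff_frobenius, frobeniusPoly, map_add, map_mul, map_pow, MvPolynomial.aeval_X,
    MvPolynomial.aeval_C]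
  refine dvd_add ?_ ?_
  · refine dvd_trans ?_ (pow_dvd_pow_of_dvd (hx n) p)
    rw [← pow_mul]
    refine pow_dvd_pow _ ?_
    have := hp.out.two_le
    nlinarith [Nat.pos_of_ne_zero hk]
  · rw [pow_succ']
    refine mul_dvd_mul (by simp) ?_
    exact dvd_aeval_of_constantCoeff_eq_zero _ (constantCoeff_frobeniusPolyAux n) _ _ hx

/-- If `p ^ N = 0` in `R`, then `F ^ N` kills the kernel of `W(R) → W(R/p)`. -/
theorem frobIter_eq_zero {N : ℕ} (hN : (p : R) ^ N = 0) (x : WittVector p R)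
    (hx : WittVector.map (Ideal.Quotient.mk (Ideal.span {(p : R)})) x = 0) :
    frobIter p R N x = 0 := by
  have key : ∀ k n, (p : R) ^ (k + 1) ∣ (frobIter p R k x).coeff n := by
    intro k
    induction k with
    | zero =>
      intro n
      have := congrArg (fun y => y.coeff n) hx
      simp only [map_coeff, zero_coeff] at this
      rw [Ideal.Quotient.eq_zero_iff_mem, Ideal.mem_span_singleton] at this
      simpa [frobIter] using this
    | succ k ih => exact pow_dvd_coeff_frobenius (k + 1) k.succ_ne_zero _ ih
  ext n
  have := key N n
  rw [pow_succ, hN, zero_mul, zero_dvd_iff] at this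
  rw [this, zero_coeff]

/-- So `F ^ N` factors through `W(R/p)`: identities in characteristic `p` hold for arbitrary lifts
after applying `F ^ N`. -/
theorem frobIter_eq_of_map_eq {N : ℕ} (hN : (p : R) ^ N = 0) (x y : WittVector p R)
    (hx : WittVector.map (Ideal.Quotient.mk (Ideal.span {(p : R)})) x =
      WittVector.map (Ideal.Quotient.mk (Ideal.span {(p : R)})) y) :
    frobIter p R N x = frobIter p R N y := by
  rw [← sub_eq_zero, ← map_sub]
  exact frobIter_eq_zero hN _ (by rw [map_sub, hx, sub_self])

theorem charP_quotient_span (R : Type*) [CommRing R] [Nontrivial (R ⧸ Ideal.span {(p : R)})] :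
    CharP (R ⧸ Ideal.span {(p : R)}) p := by
  have h : (p : R ⧸ Ideal.span {(p : R)}) = 0 := by
    rw [← map_natCast (Ideal.Quotient.mk (Ideal.span {(p : R)})), Ideal.Quotient.eq_zero_iff_mem]
    exact Ideal.mem_span_singleton_self _
  obtain ⟨q, hq⟩ := CharP.exists (R ⧸ Ideal.span {(p : R)})
  have hd : q ∣ p := (CharP.cast_eq_zero_iff _ q p).1 h
  rcases (Nat.dvd_prime hp.out).1 hd with h1 | h1
  · subst h1
    exact absurd (CharP.CharOne.subsingleton (R := R ⧸ Ideal.span {(p : R)}))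
      (not_subsingleton _)
  · exact h1 ▸ hq

/-- If `p ^ N = 0` in `R` and `x ∈ W(R)` has leading coefficient `1`, then `F ^ N x` is a unit. -/
theorem isUnit_frobIter {N : ℕ} (hN : (p : R) ^ N = 0) (x : WittVector p R) (hx : x.coeff 0 = 1) :
    IsUnit (frobIter p R N x) := by
  set π := Ideal.Quotient.mk (Ideal.span {(p : R)})
  -- Modulo `p`, the leading coefficient `1` already makes `x` invertible. A lift of that inverse
  -- need not invert `x`, but it does after `F ^ N`.
  obtain ⟨y, hy⟩ : ∃ y, WittVector.map π x * y = 1 := by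
    rcases subsingleton_or_nontrivial (R ⧸ Ideal.span {(p : R)}) with h | h
    · refine ⟨0, ?_⟩
      ext n
      exact Subsingleton.elim _ _
    · have := charP_quotient_span (p := p) R
      have h1 : (WittVector.map π x).coeff 0 = ((1 : (R ⧸ Ideal.span {(p : R)})ˣ) : _) := by
        rw [map_coeff, hx, map_one, Units.val_one]
      refine ⟨((mkUnit h1)⁻¹ : (WittVector p _)ˣ), ?_⟩
      have h2 := Units.mul_inv (mkUnit h1)
      rwa [coe_mkUnit] at h2
  obtain ⟨z, rfl⟩ := WittVector.map_surjective π Ideal.Quotient.mk_surjective y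
  refine IsUnit.of_mul_eq_one (frobIter p R N z) ?_
  rw [← map_mul, ← map_one (frobIter p R N)]
  exact frobIter_eq_of_map_eq hN _ _ (by rw [map_mul, hy, map_one])

/-! #### Solving `z = C F(z)` -/

variable {K : Type*} [Fintype K] [DecidableEq K]

/-- The matrix `C F(C) ⋯ F^{n-1}(C)`. -/
noncomputable def frobProd (C : Matrix K K (WittVector p R)) : ℕ → Matrix K K (WittVector p R)
  | 0 => 1
  | n + 1 => C * (frobProd C n).map frobenius

theorem frobProd_succ' (C : Matrix K K (WittVector p R)) (n : ℕ) :
    frobProd C (n + 1) = frobProd C n * C.map (frobIter p R n) := by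
  induction n with
  | zero =>
    simp only [frobProd]
    rw [Matrix.map_one _ (map_zero _) (map_one _), mul_one, one_mul]
    rfl
  | succ n ih =>
    change C * (frobProd C (n + 1)).map frobenius = C * (frobProd C n).map frobenius * _
    rw [ih, Matrix.map_mul, ← mul_assoc, Matrix.map_map]
    rfl

theorem eq_frobProd_mulVec (C : Matrix K K (WittVector p R)) (z : K → WittVector p R)
    (hz : z = C.mulVec (frobenius ∘ z)) (n : ℕ) :
    z = (frobProd C n).mulVec (frobIter p R n ∘ z) := by
  induction n with
  | zero => rw [frobProd, Matrix.one_mulVec]; rfl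
  | succ n ih =>
    have : frobenius ∘ z = ((frobProd C n).map frobenius).mulVec (frobIter p R (n + 1) ∘ z) := by
      funext i
      conv_lhs => rw [ih]
      exact RingHom.map_mulVec _ _ _ i
    rw [frobProd, ← Matrix.mulVec_mulVec, ← this]
    exact hz

/-- Multiplication by `C F(C) ⋯ F^{n-1}(C)` turns solutions of the `F^n`-twisted equation into
solutions of the original one, by the two recursions for this product. -/
theorem frobProd_mulVec_eq (C : Matrix K K (WittVector p R)) (n : ℕ) (z : K → WittVector p R)
    (hz : z = (C.map (frobIter p R n)).mulVec (frobenius ∘ z)) :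
    (frobProd C n).mulVec z = C.mulVec (frobenius ∘ (frobProd C n).mulVec z) := by
  have : frobenius ∘ (frobProd C n).mulVec z =
      ((frobProd C n).map frobenius).mulVec (frobenius ∘ z) :=
    funext fun i => RingHom.map_mulVec _ _ _ i
  rw [this, Matrix.mulVec_mulVec, ← frobProd, frobProd_succ', ← Matrix.mulVec_mulVec, ← hz]

/-- The projection formula `a · V^n(b) = V^n(F^n(a) · b)`, summed over a row. -/
theorem mulVec_iterate_verschiebung (C : Matrix K K (WittVector p R)) (n : ℕ)
    (z : K → WittVector p R) (i : K) :
    C.mulVec (fun j => verschiebung^[n] (z j)) i =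
      verschiebung^[n] ((C.map (frobIter p R n)).mulVec z i) := by
  have hadd : ∀ s : Finset K, ∀ f : K → WittVector p R,
      ∑ j ∈ s, verschiebung^[n] (f j) = verschiebung^[n] (∑ j ∈ s, f j) := fun s f => by
    classical
    induction s using Finset.induction_on with
    | empty => simp [iterate_map_zero]
    | insert a s ha ih => rw [Finset.sum_insert ha, Finset.sum_insert ha, iterate_map_add, ih]
  simp only [Matrix.mulVec, dotProduct, ← hadd, Matrix.map_apply]
  refine Finset.sum_congr rfl fun j _ => ?_
  rw [mul_comm, iterate_verschiebung_mul_left, frobIter_eq_iterate, mul_comm]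

/-- Here `F` raises components to `p`-th powers, so `F^n δ` lies in the image of `V^m` for large
`n`. Then so does `δ = C F(C) ⋯ F^{n-1}(C) F^n(δ)`, say `δ = V^m z`. As `V` is injective and
commutes with `F`, `z` solves the `F^m`-twisted equation. Expanding `δ` once more, now `m` times,
gives the factor `F^m V^m = p ^ m`. -/
theorem exists_eq_pow_smul_of_charP [CharP R p] (C : Matrix K K (WittVector p R))
    (δ : K → WittVector p R) (hδ : δ = C.mulVec (frobenius ∘ δ)) (m : ℕ)
    (hm : ∀ k, ∀ i < m, IsNilpotent ((δ k).coeff i)) :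
    ∃ u : K → WittVector p R, (∀ k, δ k = (p : WittVector p R) ^ m * u k) ∧
      u = C.mulVec (frobenius ∘ u) := by
  obtain ⟨n, hn⟩ : ∃ n, ∀ k, ∀ i < m, (δ k).coeff i ^ n = 0 := by
    have : ∀ q : K × Fin m, ∃ n, (δ q.1).coeff q.2 ^ n = 0 := fun q => hm q.1 q.2 q.2.2
    choose n hn using this
    refine ⟨Finset.univ.sup n, fun k i hi => ?_⟩
    exact pow_eq_zero_of_le (Finset.le_sup (Finset.mem_univ (k, (⟨i, hi⟩ : Fin m))))
      (hn (k, ⟨i, hi⟩))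
  have h1 : ∀ k, frobIter p R n (δ k) = verschiebung^[m] ((frobIter p R n (δ k)).shift m) := by
    intro k
    refine eq_iterate_verschiebung fun i hi => ?_
    rw [frobIter_eq_iterate, iterate_frobenius_coeff]
    exact pow_eq_zero_of_le (Nat.lt_pow_self hp.out.one_lt).le (hn k i hi)
  set y : K → WittVector p R := fun k => (frobIter p R n (δ k)).shift m
  set z : K → WittVector p R := ((frobProd C n).map (frobIter p R m)).mulVec y
  have h2 : δ = fun k => verschiebung^[m] (z k) := by
    funext k
    conv_lhs => rw [eq_frobProd_mulVec C δ hδ n]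
    rw [← mulVec_iterate_verschiebung]
    congr 1
    funext j
    exact h1 j
  have hVinj : Function.Injective (verschiebung (p := p) (R := R))^[m] :=
    (verschiebung_injective p R).iterate m
  have hcomm : ∀ x : WittVector p R,
      frobenius (verschiebung^[m] x) = verschiebung^[m] (frobenius x) := fun x =>
    ((verschiebung_frobenius_comm (p := p) (R := R)).iterate_left m x).symm
  have h3 : z = (C.map (frobIter p R m)).mulVec (frobenius ∘ z) := by
    funext k
    apply hVinj
    rw [← mulVec_iterate_verschiebung C m (frobenius ∘ z) k]
    change (fun k => verschiebung^[m] (z k)) k = _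
    rw [← h2]
    conv_lhs => rw [hδ]
    congr 1
    funext j
    rw [h2]
    exact hcomm _
  refine ⟨(frobProd C m).mulVec z, fun k => ?_, frobProd_mulVec_eq C m z h3⟩
  conv_lhs => rw [eq_frobProd_mulVec C δ hδ m]
  have : frobIter p R m ∘ δ = (p : WittVector p R) ^ m • z := by
    funext j
    rw [h2]
    exact frobIter_iterate_verschiebung m _
  rw [this, Matrix.mulVec_smul]
  rfl

/-- If `δ = C F(δ)` and the first `m` Witt components of `δ` are nilpotent, then `δ = p ^ m u` with
`u = C F(u)`. -/
theorem exists_eq_pow_smul {N : ℕ} (hN : (p : R) ^ N = 0) (C : Matrix K K (WittVector p R))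
    (δ : K → WittVector p R) (hδ : δ = C.mulVec (frobenius ∘ δ)) (m : ℕ)
    (hm : ∀ k, ∀ i < m, IsNilpotent ((δ k).coeff i)) :
    ∃ u : K → WittVector p R, (∀ k, δ k = (p : WittVector p R) ^ m * u k) ∧
      u = C.mulVec (frobenius ∘ u) := by
  set π := Ideal.Quotient.mk (Ideal.span {(p : R)})
  set w : WittVector p R →+* WittVector p _ := WittVector.map π
  have hw : Function.Surjective w := WittVector.map_surjective π Ideal.Quotient.mk_surjective
  obtain ⟨v, hv1, hv2⟩ : ∃ v : K → WittVector p (R ⧸ Ideal.span {(p : R)}),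
      (∀ k, w (δ k) = (p : WittVector p _) ^ m * v k) ∧
        v = (C.map w).mulVec (frobenius ∘ v) := by
    rcases subsingleton_or_nontrivial (R ⧸ Ideal.span {(p : R)}) with h | h
    · have hs : Subsingleton (WittVector p (R ⧸ Ideal.span {(p : R)})) :=
        ⟨fun a b => by ext n; exact Subsingleton.elim _ _⟩
      exact ⟨0, fun k => Subsingleton.elim _ _, funext fun k => Subsingleton.elim _ _⟩
    · have := charP_quotient_span (p := p) R
      refine exists_eq_pow_smul_of_charP (C.map w) (w ∘ δ) ?_ m fun k i hi => ?_
      · funext k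
        conv_lhs => rw [hδ]
        refine (RingHom.map_mulVec w _ _ k).trans ?_
        congr 1
        funext j
        exact map_frobenius π _
      · simp only [Function.comp, w, map_coeff]
        exact (hm k i hi).map π
  -- An arbitrary lift of the solution `v` over `R/p`. Applying `F ^ N` makes it an exact solution
  -- of the `F^N`-twisted equation, and `frobProd C N` untwists it.
  choose û hû using fun k => hw (v k)
  have key : ∀ x y, w x = w y → frobIter p R N x = frobIter p R N y :=
    frobIter_eq_of_map_eq hN
  refine ⟨(frobProd C N).mulVec (frobIter p R N ∘ û), fun k => ?_,
    frobProd_mulVec_eq C N _ ?_⟩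
  · conv_lhs => rw [eq_frobProd_mulVec C δ hδ N]
    have : frobIter p R N ∘ δ = (p : WittVector p R) ^ m • (frobIter p R N ∘ û) := by
      funext j
      have := key (δ j) ((p : WittVector p R) ^ m * û j) (by
        rw [map_mul, map_pow, map_natCast, hû, hv1])
      simpa using this
    rw [this, Matrix.mulVec_smul]
    rfl
  · funext k
    have h1 := key (û k) (C.mulVec (frobenius ∘ û) k) (by
      rw [hû, RingHom.map_mulVec]
      conv_lhs => rw [hv2]
      congr 1
      funext j
      exact (congrArg frobenius (hû j).symm).trans (map_frobenius π _).symm)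
    refine h1.trans ((RingHom.map_mulVec _ _ _ k).trans ?_)
    congr 1
    funext j
    exact frobIter_frobenius _ _

end WittVectors


/-! ### Divided Frobenius twists of block matrices -/

section Adjugate

variable {K : Type*} [CommRing K] {m n : Type*} [Fintype m] [Fintype n] [DecidableEq m]
  [DecidableEq n]

/-- The block diagonal matrix `diag(q, 1)`. -/
def diagSMulOne (m n : Type*) [DecidableEq m] [DecidableEq n] (q : K) :
    Matrix (m ⊕ n) (m ⊕ n) K :=
  Matrix.fromBlocks (q • 1) 0 0 1

theorem det_diagSMulOne (q : K) : (diagSMulOne m n q).det = q ^ Fintype.card m := by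
  rw [diagSMulOne, Matrix.det_fromBlocks_zero₂₁, Matrix.det_smul, Matrix.det_one, Matrix.det_one,
    mul_one, mul_one]

theorem det_eq_of_diagSMulOne_mul {q : K} (hq : IsRegular q) {y z : Matrix (m ⊕ n) (m ⊕ n) K}
    (h : diagSMulOne m n q * y = z * diagSMulOne m n q) : y.det = z.det := by
  have := congrArg Matrix.det h
  rw [Matrix.det_mul, Matrix.det_mul, det_diagSMulOne, mul_comm] at this
  exact (hq.pow _).right this

/-- Take adjugates of `D y = z D`, with `D = diag(q, 1)`, and multiply by `D` on both sides. Since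
`D · adj D` is the scalar `det D`, a power of the regular element `q`, it cancels. -/
theorem diagSMulOne_mul_adjugate {q : K} (hq : IsRegular q) {y z : Matrix (m ⊕ n) (m ⊕ n) K}
    (h : diagSMulOne m n q * y = z * diagSMulOne m n q) :
    diagSMulOne m n q * y.adjugate = z.adjugate * diagSMulOne m n q := by
  have h1 := congrArg Matrix.adjugate h
  rw [Matrix.adjugate_mul_distrib, Matrix.adjugate_mul_distrib] at h1
  have h2 : q ^ Fintype.card m • (diagSMulOne m n q * y.adjugate) =
      q ^ Fintype.card m • (z.adjugate * diagSMulOne m n q) := by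
    rw [← det_diagSMulOne (n := n)]
    calc _ = diagSMulOne m n q * (y.adjugate * (diagSMulOne m n q).adjugate) *
          diagSMulOne m n q := by
            rw [mul_assoc, mul_assoc, Matrix.adjugate_mul, Matrix.mul_smul, Matrix.mul_smul, mul_one]
      _ = _ := by
            rw [h1, ← mul_assoc, Matrix.mul_adjugate, Matrix.smul_mul, one_mul, Matrix.smul_mul]
  ext i j
  exact (hq.pow _).left (congrFun (congrFun h2 i) j)

theorem diagSMulOne_mul_eq_iff (q : K) (y z : Matrix (m ⊕ n) (m ⊕ n) K) :
    diagSMulOne m n q * y = z * diagSMulOne m n q ↔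
      q • y.toBlocks₁₁ = q • z.toBlocks₁₁ ∧ q • y.toBlocks₁₂ = z.toBlocks₁₂ ∧
        y.toBlocks₂₁ = q • z.toBlocks₂₁ ∧ y.toBlocks₂₂ = z.toBlocks₂₂ := by
  conv_lhs => rw [← Matrix.fromBlocks_toBlocks y, ← Matrix.fromBlocks_toBlocks z]
  rw [diagSMulOne, Matrix.fromBlocks_multiply, Matrix.fromBlocks_multiply, Matrix.fromBlocks_inj]
  simp

/-- Over `K[X]` a block lower triangular `z` fits into `diag(X, 1) y = z diag(X, 1)`. The adjugates
satisfy the same relation, so the upper right block of `adj z` is divisible by `X`. Its entries are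
constants; evaluate at `0`. -/
theorem adjugate_toBlocks₁₂_eq_zero {z : Matrix (m ⊕ n) (m ⊕ n) K} (hz : z.toBlocks₁₂ = 0) :
    z.adjugate.toBlocks₁₂ = 0 := by
  have hX : IsRegular (Polynomial.X : Polynomial K) := Polynomial.isRegular_X
  set zX := Polynomial.C.mapMatrix z
  have h := diagSMulOne_mul_adjugate (m := m) (n := n) hX
    (y := Matrix.fromBlocks zX.toBlocks₁₁ 0 ((Polynomial.X : Polynomial K) • zX.toBlocks₂₁)
      zX.toBlocks₂₂) (z := zX) (by
      rw [diagSMulOne_mul_eq_iff]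
      simp only [Matrix.toBlocks_fromBlocks₁₁, Matrix.toBlocks_fromBlocks₁₂,
        Matrix.toBlocks_fromBlocks₂₁, Matrix.toBlocks_fromBlocks₂₂, true_and, and_true, smul_zero]
      refine Matrix.ext fun i j => ?_
      have := congrFun (congrFun hz i) j
      change z _ _ = 0 at this
      change 0 = Polynomial.C (z _ _)
      rw [this, map_zero])
  rw [diagSMulOne_mul_eq_iff] at h
  ext i j
  have h1 := congrFun (congrFun h.2.1 i) j
  rw [← RingHom.map_adjugate] at h1
  have h2 := congrArg (Polynomial.eval 0) h1
  rw [Matrix.smul_apply, smul_eq_mul, Polynomial.eval_mul, Polynomial.eval_X, zero_mul] at h2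
  simpa [Matrix.toBlocks₁₂] using h2.symm

end Adjugate

/-! ### The divided Frobenius twist over Witt vectors. -/

section Hat

variable {p : ℕ} [hp : Fact p.Prime] {R : Type*} [CommRing R]

/-- `y` is the divided Frobenius twist of the block matrix `z`, whose upper right block has entries
in the augmentation ideal: the blocks of `y` are `F(z₁₁)`, `V⁻¹(z₁₂)`, `p F(z₂₁)`, `F(z₂₂)`. -/
structure IsTwist {m n m' n' : Type*} (z y : Matrix (m ⊕ n) (m' ⊕ n') (WittVector p R)) : Prop where
  apply₁₁ : ∀ i j, y (.inl i) (.inl j) = frobenius (z (.inl i) (.inl j))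
  apply₁₂ : ∀ i j, z (.inl i) (.inr j) = verschiebung (y (.inl i) (.inr j))
  apply₂₁ : ∀ i j, y (.inr i) (.inl j) = (p : WittVector p R) * frobenius (z (.inr i) (.inl j))
  apply₂₂ : ∀ i j, y (.inr i) (.inr j) = frobenius (z (.inr i) (.inr j))

namespace IsTwist

variable {m n m' n' m'' n'' : Type*}

theorem frobenius_apply₁₂ {z y : Matrix (m ⊕ n) (m' ⊕ n') (WittVector p R)} (h : IsTwist z y)
    (i : m) (j : n') :
    frobenius (z (.inl i) (.inr j)) = (p : WittVector p R) * y (.inl i) (.inr j) := by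
  rw [h.apply₁₂, frobenius_verschiebung, mul_comm]

theorem zero : IsTwist (0 : Matrix (m ⊕ n) (m' ⊕ n') (WittVector p R)) 0 := by
  constructor <;> intros <;> simp

theorem add {z y z' y' : Matrix (m ⊕ n) (m' ⊕ n') (WittVector p R)} (h : IsTwist z y)
    (h' : IsTwist z' y') : IsTwist (z + z') (y + y') := by
  constructor <;> intro i j <;> simp only [Matrix.add_apply, map_add]
  · rw [h.apply₁₁, h'.apply₁₁]
  · rw [h.apply₁₂, h'.apply₁₂]
  · rw [h.apply₂₁, h'.apply₂₁, mul_add]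
  · rw [h.apply₂₂, h'.apply₂₂]

theorem sum {ι : Type*} (s : Finset ι)
    {z y : ι → Matrix (m ⊕ n) (m' ⊕ n') (WittVector p R)} (h : ∀ k, IsTwist (z k) (y k)) :
    IsTwist (∑ k ∈ s, z k) (∑ k ∈ s, y k) := by
  classical
  induction s using Finset.induction_on with
  | empty => exact zero
  | insert a s ha ih => rw [Finset.sum_insert ha, Finset.sum_insert ha]; exact (h a).add ih

theorem smul (r : WittVector p R) {z y : Matrix (m ⊕ n) (m' ⊕ n') (WittVector p R)}
    (h : IsTwist z y) : IsTwist (r • z) (frobenius r • y) := by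
  constructor <;> intro i j <;> simp only [Matrix.smul_apply, smul_eq_mul, map_mul]
  · rw [h.apply₁₁]
  · rw [h.apply₁₂, mul_comm, ← verschiebung_mul_frobenius, mul_comm]
  · rw [h.apply₂₁]; ring
  · rw [h.apply₂₂]

theorem submatrix {z y : Matrix (m ⊕ n) (m' ⊕ n') (WittVector p R)} (h : IsTwist z y)
    {k l k' l' : Type*} (f : k → m) (g : l → n) (f' : k' → m') (g' : l' → n') :
    IsTwist (z.submatrix (Sum.map f g) (Sum.map f' g'))
      (y.submatrix (Sum.map f g) (Sum.map f' g')) := by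
  constructor <;> intro i j
  · exact h.apply₁₁ _ _
  · exact h.apply₁₂ _ _
  · exact h.apply₂₁ _ _
  · exact h.apply₂₂ _ _

theorem fromBlocks_diagonal (a : Matrix m m' (WittVector p R)) (d : Matrix n n' (WittVector p R)) :
    IsTwist (Matrix.fromBlocks a 0 0 d) ((Matrix.fromBlocks a 0 0 d).map frobenius) := by
  constructor <;> intros <;> simp

/-- Products of off-diagonal blocks match because the `p` in the lower left block absorbs `F V = p`;
the upper right block uses the projection formula for `V`. -/
theorem mul [Fintype m'] [Fintype n'] {z y : Matrix (m ⊕ n) (m' ⊕ n') (WittVector p R)}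
    {z' y' : Matrix (m' ⊕ n') (m'' ⊕ n'') (WittVector p R)} (h : IsTwist z y)
    (h' : IsTwist z' y') : IsTwist (z * z') (y * y') := by
  constructor <;> intro i j <;>
    simp only [Matrix.mul_apply, Fintype.sum_sum_type, map_add, map_sum, map_mul]
  · refine congrArg₂ _ (Finset.sum_congr rfl fun k _ => ?_) (Finset.sum_congr rfl fun k _ => ?_)
    · rw [h.apply₁₁, h'.apply₁₁]
    · rw [h.frobenius_apply₁₂, h'.apply₂₁]; ring
  · refine congrArg₂ _ (Finset.sum_congr rfl fun k _ => ?_) (Finset.sum_congr rfl fun k _ => ?_)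
    · rw [h.apply₁₁, h'.apply₁₂, mul_comm, ← verschiebung_mul_frobenius, mul_comm]
    · rw [h.apply₁₂, h'.apply₂₂, verschiebung_mul_frobenius]
  · rw [mul_add, Finset.mul_sum, Finset.mul_sum]
    refine congrArg₂ _ (Finset.sum_congr rfl fun k _ => ?_) (Finset.sum_congr rfl fun k _ => ?_)
    · rw [h.apply₂₁, h'.apply₁₁]; ring
    · rw [h.apply₂₂, h'.apply₂₁]; ring
  · refine congrArg₂ _ (Finset.sum_congr rfl fun k _ => ?_) (Finset.sum_congr rfl fun k _ => ?_)
    · rw [h.apply₂₁, h'.frobenius_apply₁₂]; ring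
    · rw [h.apply₂₂, h'.apply₂₂]

theorem map {S : Type*} [CommRing S] (f : R →+* S)
    {z y : Matrix (m ⊕ n) (m' ⊕ n') (WittVector p R)} (h : IsTwist z y) :
    IsTwist (z.map (WittVector.map f)) (y.map (WittVector.map f)) := by
  constructor <;> intro i j <;> simp only [Matrix.map_apply]
  · rw [h.apply₁₁, map_frobenius]
  · rw [h.apply₁₂, map_verschiebung]
  · rw [h.apply₂₁, map_mul, map_natCast, map_frobenius]
  · rw [h.apply₂₂, map_frobenius]

/-- Three blocks of `z` and the upper right block of `y` can be lifted freely; they determine the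
rest. This permits reduction to rings over which `p` is regular. -/
theorem exists_lift {S : Type*} [CommRing S] (f : S →+* R) (hf : Function.Surjective f)
    {z y : Matrix (m ⊕ n) (m' ⊕ n') (WittVector p R)} (h : IsTwist z y) :
    ∃ z' y' : Matrix (m ⊕ n) (m' ⊕ n') (WittVector p S), IsTwist z' y' ∧
      z'.map (WittVector.map f) = z ∧ y'.map (WittVector.map f) = y := by
  choose s hs using WittVector.map_surjective (p := p) f hf
  refine ⟨Matrix.fromBlocks (.of fun i j => s (z (.inl i) (.inl j)))
      (.of fun i j => verschiebung (s (y (.inl i) (.inr j))))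
      (.of fun i j => s (z (.inr i) (.inl j))) (.of fun i j => s (z (.inr i) (.inr j))),
    Matrix.fromBlocks (.of fun i j => frobenius (s (z (.inl i) (.inl j))))
      (.of fun i j => s (y (.inl i) (.inr j)))
      (.of fun i j => (p : WittVector p S) * frobenius (s (z (.inr i) (.inl j))))
      (.of fun i j => frobenius (s (z (.inr i) (.inr j)))), ?_, ?_, ?_⟩
  · constructor <;> intro i j <;> rfl
  · ext1 i j
    rcases i with i | i <;> rcases j with j | j <;>
      simp [hs, map_verschiebung, h.apply₁₂]
  · ext1 i j
    rcases i with i | i <;> rcases j with j | j <;>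
      simp [hs, map_frobenius, h.apply₁₁, h.apply₂₁, h.apply₂₂]

end IsTwist

/-- Over a `ℚ`-algebra the ghost map is bijective onto a product in which `p` is invertible, and
`W(f)` is injective. -/
theorem isRegular_natCast_of_injective {A : Type*} [CommRing A] [Algebra ℚ A] (f : R →+* A)
    (hf : Function.Injective f) : IsRegular (p : WittVector p R) := by
  have hu : IsUnit (p : A) := by
    have h : IsUnit (p : ℚ) := isUnit_iff_ne_zero.2 (Nat.cast_ne_zero.2 hp.out.ne_zero)
    simpa using h.map (algebraMap ℚ A)
  let _ : Invertible (p : A) := hu.invertible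
  have hg := (ghostMap.bijective_of_invertible p A).injective
  have key : ∀ x y : WittVector p R,
      (p : WittVector p R) * x = (p : WittVector p R) * y → x = y := by
    intro x y h
    apply WittVector.map_injective f hf
    apply hg
    have h1 := congrArg (fun w => ghostMap (WittVector.map f w)) h
    simp only [map_mul, map_natCast] at h1
    funext i
    have h2 := congrFun h1 i
    exact hu.mul_left_cancel h2
  exact isRegular_iff.2 ⟨fun x y h => key x y h,
    fun x y h => key x y (by simpa only [mul_comm] using h)⟩

section Square

variable {m n : Type*} [Fintype m] [Fintype n] [DecidableEq m] [DecidableEq n]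
variable {z y : Matrix (m ⊕ n) (m ⊕ n) (WittVector p R)}

theorem IsTwist.diagSMulOne_mul (h : IsTwist z y) :
    diagSMulOne m n (p : WittVector p R) * y = z.map frobenius * diagSMulOne m n (p : WittVector p R) := by
  rw [diagSMulOne_mul_eq_iff]
  refine ⟨congrArg _ ?_, ?_, ?_, ?_⟩ <;> refine Matrix.ext fun i j => ?_
  · exact h.apply₁₁ i j
  · rw [Matrix.smul_apply, smul_eq_mul]
    exact (h.frobenius_apply₁₂ i j).symm
  · rw [Matrix.smul_apply, smul_eq_mul]
    exact h.apply₂₁ i j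
  · exact h.apply₂₂ i j

/-- With `D = diag(p, 1)`, a twist satisfies `D y = F(z) D`; this passes to determinants and
adjugates. The upper right block of `adj z` vanishes modulo the augmentation ideal, so its entries
are of the form `V x`, and cancelling `p` in `F V x = p x` identifies the corresponding entries of
`adj y`. -/
theorem IsTwist.of_isRegular (hp : IsRegular (p : WittVector p R)) (h : IsTwist z y) :
    y.det = frobenius z.det ∧ IsTwist z.adjugate y.adjugate := by
  refine ⟨?_, ?_⟩
  · exact (det_eq_of_diagSMulOne_mul hp h.diagSMulOne_mul).trans
      (RingHom.map_det frobenius z).symm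
  have h1 := diagSMulOne_mul_adjugate hp h.diagSMulOne_mul
  have h2 : (z.map frobenius).adjugate = z.adjugate.map frobenius :=
    (RingHom.map_adjugate frobenius z).symm
  rw [h2, diagSMulOne_mul_eq_iff] at h1
  obtain ⟨h11, h12, h21, h22⟩ := h1
  refine ⟨fun i j => hp.left (congrFun (congrFun h11 i) j), fun i j => ?_,
    fun i j => congrFun (congrFun h21 i) j, fun i j => congrFun (congrFun h22 i) j⟩
  have h0 : (z.adjugate (.inl i) (.inr j)).coeff 0 = 0 := by
    have h3 := adjugate_toBlocks₁₂_eq_zero (z := constantCoeff.mapMatrix z) (by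
      ext i j
      change (z (.inl i) (.inr j)).coeff 0 = 0
      rw [h.apply₁₂, verschiebung_coeff_zero])
    rw [← RingHom.map_adjugate] at h3
    exact congrFun (congrFun h3 i) j
  obtain ⟨x, hx⟩ : ∃ x, z.adjugate (.inl i) (.inr j) = verschiebung x :=
    ⟨_, (verschiebung_shift_one ⟨z.adjugate (.inl i) (.inr j), h0⟩).symm⟩
  rw [hx]
  congr 1
  apply hp.left
  have h5 : (p : WittVector p R) * y.adjugate (.inl i) (.inr j) =
    frobenius (z.adjugate (.inl i) (.inr j)) := congrFun (congrFun h12 i) j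
  change (p : WittVector p R) * _ = (p : WittVector p R) * _
  rw [h5, hx, frobenius_verschiebung, mul_comm]

/-- The identities are universal: lift to a polynomial ring over `ℤ` surjecting onto `R`, where `p`
is regular in the Witt vectors, and map back. -/
theorem IsTwist.det_and_adjugate (h : IsTwist z y) :
    y.det = frobenius z.det ∧ IsTwist z.adjugate y.adjugate := by
  have hf : Function.Surjective (MvPolynomial.aeval (R := ℤ) (id : R → R)).toRingHom :=
    fun r => ⟨MvPolynomial.X r, MvPolynomial.aeval_X _ r⟩
  have hr : IsRegular (p : WittVector p (MvPolynomial R ℤ)) :=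
    isRegular_natCast_of_injective (MvPolynomial.map (Int.castRingHom ℚ))
      (MvPolynomial.map_injective _ Int.cast_injective)
  obtain ⟨z', y', h', rfl, rfl⟩ := h.exists_lift _ hf
  set w : WittVector p (MvPolynomial R ℤ) →+* WittVector p R := WittVector.map
    (MvPolynomial.aeval (R := ℤ) (id : R → R)).toRingHom
  obtain ⟨hd, ha⟩ := h'.of_isRegular hr
  constructor
  · have e1 : (y'.map w).det = w y'.det := (RingHom.map_det w y').symm
    have e2 : (z'.map w).det = w z'.det := (RingHom.map_det w z').symm
    rw [e1, e2, hd, map_frobenius]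
  · have e1 : (y'.map w).adjugate = y'.adjugate.map w := (RingHom.map_adjugate w y').symm
    have e2 : (z'.map w).adjugate = z'.adjugate.map w := (RingHom.map_adjugate w z').symm
    rw [e1, e2]
    exact ha.map _

end Square

end Hat


/-! ### Windows in matrix form -/

section Minors

variable {S : Type*} [CommRing S] {H N N' 𝒜 𝒜' : Type*} [Fintype H] [DecidableEq H] [Fintype N]
  [Fintype N'] [Fintype 𝒜] [Fintype 𝒜']

/-- A factorization `E = A B` with `B A = 1`, such that the minors of `A` and of `B` given by the
index functions `idx α` generate the unit ideal. -/
structure Splitting (idx : 𝒜 → H → N) (E : Matrix N N S) where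
  A : Matrix N H S
  B : Matrix H N S
  mul_eq : A * B = E
  mul_eq_one : B * A = 1
  coeffA : 𝒜 → S
  coeffB : 𝒜 → S
  sum_coeffA : ∑ α, coeffA α * (A.submatrix (idx α) id).det = 1
  sum_coeffB : ∑ α, coeffB α * (B.submatrix id (idx α)).det = 1

namespace Splitting

variable {idx : 𝒜 → H → N} {idx' : 𝒜' → H → N'} {E : Matrix N N S} {E' : Matrix N' N' S}

theorem mul_E_mul (s : Splitting idx E) : s.B * E * s.A = 1 := by
  have h : s.B * (s.A * s.B) * s.A = 1 := by
    rw [← Matrix.mul_assoc, s.mul_eq_one, Matrix.one_mul, s.mul_eq_one]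
  exact (congrArg (fun x => s.B * x * s.A) s.mul_eq.symm).trans h

theorem E_mul_A (s : Splitting idx E) : E * s.A = s.A := by
  have h : s.A * s.B * s.A = s.A := by rw [Matrix.mul_assoc, s.mul_eq_one, Matrix.mul_one]
  exact (congrArg (· * s.A) s.mul_eq.symm).trans h

/-- The minors of `A`. -/
def a (s : Splitting idx E) (α : 𝒜) : S := (s.A.submatrix (idx α) id).det

/-- The minors of `B`. -/
def b (s : Splitting idx E) (α : 𝒜) : S := (s.B.submatrix id (idx α)).det

/-- The products of the minors of `A'` and of `B`. -/
def θ (s' : Splitting idx' E') (s : Splitting idx E) (k : 𝒜' × 𝒜) : S := s'.a k.1 * s.b k.2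

theorem sum_θ (s' : Splitting idx' E') (s : Splitting idx E) :
    ∃ c : 𝒜' × 𝒜 → S, ∑ k, c k * θ s' s k = 1 := by
  refine ⟨fun k => s'.coeffA k.1 * s.coeffB k.2, ?_⟩
  have := congrArg₂ (· * ·) s'.sum_coeffA s.sum_coeffB
  rw [mul_one, Finset.sum_mul_sum, ← Fintype.sum_prod_type'] at this
  rw [← this]
  exact Finset.sum_congr rfl fun k _ => by simp only [θ, a, b]; ring

theorem eq_of_θ (s' : Splitting idx' E') (s : Splitting idx E) {x y : S}
    (h : ∀ k, θ s' s k * x = θ s' s k * y) : x = y := by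
  obtain ⟨c, hc⟩ := sum_θ s' s
  rw [← one_mul x, ← one_mul y, ← hc, Finset.sum_mul, Finset.sum_mul]
  exact Finset.sum_congr rfl fun k _ => by rw [mul_assoc, h, mul_assoc]

/-- The submatrix is a product of three `H × H` matrices. So all these minors are multiples of the
single determinant of `x`. -/
theorem det_submatrix_mul (s' : Splitting idx' E') (s : Splitting idx E) (x : Matrix H H S)
    (α' : 𝒜') (α : 𝒜) :
    ((s'.A * x * s.B).submatrix (idx' α') (idx α)).det = s'.a α' * x.det * s.b α := by
  rw [Matrix.submatrix_mul _ _ _ id _ Function.bijective_id,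
    Matrix.submatrix_mul _ _ _ id _ Function.bijective_id, Matrix.det_mul, Matrix.det_mul,
    Matrix.submatrix_id_id]
  rfl

theorem mul_mul_eq (s' : Splitting idx' E') (s : Splitting idx E) (x : Matrix N' N S)
    (h' : E' * x = x) (h : x * E = x) : s'.A * (s'.B * x * s.A) * s.B = x := by
  calc _ = s'.A * s'.B * x * (s.A * s.B) := by simp only [Matrix.mul_assoc]
    _ = _ := by rw [s'.mul_eq, s.mul_eq, h', h]

theorem det_submatrix (s' : Splitting idx' E') (s : Splitting idx E) (x : Matrix N' N S)
    (h' : E' * x = x) (h : x * E = x) (α' : 𝒜') (α : 𝒜) :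
    (x.submatrix (idx' α') (idx α)).det = s'.a α' * (s'.B * x * s.A).det * s.b α := by
  rw [← det_submatrix_mul, mul_mul_eq s' s x h' h]

theorem det_submatrix_self (s : Splitting idx E) (α β : 𝒜) :
    (E.submatrix (idx α) (idx β)).det = s.a α * s.b β := by
  have := det_submatrix_mul s s 1 α β
  rwa [Matrix.mul_one, s.mul_eq, Matrix.det_one, mul_one] at this

end Splitting

end Minors

/-! ### Minors and adjugates of morphisms of windows. -/

section Window

variable {W : Type u} [CommRing W] {φ : W →+* W} {H N N' 𝒜 𝒜' : Type*} [Fintype H] [DecidableEq H]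
  [Fintype N] [Fintype N'] [Fintype 𝒜] [Fintype 𝒜']

/-- An idempotent matrix `E` with mutually inverse isomorphisms `Ψ`, `Ψi` between the images of
`φ(E)` and `E`. -/
structure MatrixWindow (φ : W →+* W) (N : Type*) [Fintype N] where
  E : Matrix N N W
  Ψ : Matrix N N W
  Ψi : Matrix N N W
  Ψ_mul : Ψ * Ψi = E
  Ψi_mul : Ψi * Ψ = E.map φ
  E_mul_Ψ : E * Ψ = Ψ
  Ψi_mul_E : Ψi * E = Ψi

namespace MatrixWindow

theorem Ψ_mul_E (w : MatrixWindow φ N) : w.Ψ * w.E.map φ = w.Ψ := by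
  rw [← w.Ψi_mul, ← Matrix.mul_assoc, w.Ψ_mul, w.E_mul_Ψ]

theorem E_mul_Ψi (w : MatrixWindow φ N) : w.E.map φ * w.Ψi = w.Ψi := by
  rw [← w.Ψi_mul, Matrix.mul_assoc, w.Ψ_mul, w.Ψi_mul_E]

/-- The idempotent `E` splits, with minors of type `idx`, over every local ring. -/
def IsSplit (w : MatrixWindow φ N) (idx : 𝒜 → H → N) : Prop :=
  ∀ (S : Type u) [CommRing S] [IsLocalRing S] (ψ : W →+* S), Nonempty (Splitting idx (w.E.map ψ))

variable {w : MatrixWindow φ N} {w' : MatrixWindow φ N'} {idx : 𝒜 → H → N} {idx' : 𝒜' → H → N'}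

theorem isLocalRing_quotient (𝔮 : Ideal W) [𝔮.IsMaximal] : IsLocalRing (W ⧸ 𝔮) := by
  let _ := Ideal.Quotient.field 𝔮
  infer_instance

/-- Elements of `W` whose images in no residue field are all zero generate the unit ideal. -/
theorem exists_sum_mul_eq_one {K : Type*} [Fintype K] (x : K → W)
    (h : ∀ (𝔮 : Ideal W) [𝔮.IsMaximal], ¬ ∀ k, Ideal.Quotient.mk 𝔮 (x k) = 0) :
    ∃ c : K → W, ∑ k, c k * x k = 1 := by
  rw [← Ideal.mem_span_range_iff_exists_fun, ← Ideal.eq_top_iff_one]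
  by_contra hne
  obtain ⟨𝔮, h𝔮, hle⟩ := Ideal.exists_le_maximal _ hne
  refine h 𝔮 fun k => ?_
  rw [Ideal.Quotient.eq_zero_iff_mem]
  exact hle (Ideal.subset_span ⟨k, rfl⟩)

/-- Over a residue field the minors of `E` are the products `a α * b β`, which cannot all vanish. -/
theorem IsSplit.exists_sum_minors (hw : w.IsSplit idx) :
    ∃ c : 𝒜 × 𝒜 → W, ∑ k, c k * (w.E.submatrix (idx k.1) (idx k.2)).det = 1 := by
  refine exists_sum_mul_eq_one _ fun 𝔮 _ h => ?_
  have := isLocalRing_quotient 𝔮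
  obtain ⟨s⟩ := hw (W ⧸ 𝔮) (Ideal.Quotient.mk 𝔮)
  refine one_ne_zero (α := W ⧸ 𝔮) (s.eq_of_θ s fun k => ?_)
  have h1 := h k
  rw [RingHom.map_det] at h1
  have h2 : s.a k.1 * s.b k.2 = 0 := (s.det_submatrix_self k.1 k.2).symm.trans h1
  rw [mul_zero, mul_one]
  exact h2

/-- The coefficients used to express minors of `E` in terms of each other. -/
noncomputable def IsSplit.c (hw : w.IsSplit idx) : 𝒜 × 𝒜 → W := hw.exists_sum_minors.choose

theorem IsSplit.sum_c (hw : w.IsSplit idx) :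
    ∑ k, hw.c k * (w.E.submatrix (idx k.1) (idx k.2)).det = 1 := hw.exists_sum_minors.choose_spec

/-- The matrix `C` such that `δ = C φ(δ)` holds for the minors `δ` of a morphism `w → w'`. -/
noncomputable def transition (hw' : w'.IsSplit idx') (hw : w.IsSplit idx) :
    Matrix (𝒜' × 𝒜) (𝒜' × 𝒜) W := .of fun k l =>
  (∑ β', (w'.Ψ.submatrix (idx' k.1) (idx' β')).det * φ (hw'.c (l.1, β'))) *
    ∑ β, φ (hw.c (β, l.2)) * (w.Ψi.submatrix (idx β) (idx k.2)).det

/-! ### Windows in local bases. -/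

section Local

variable {S : Type u} [CommRing S] {ψ : W →+* S}

theorem map_mul_eq (x : Matrix N' N W) {a : Matrix N' N' W} (h : a * x = x) :
    a.map ψ * x.map ψ = x.map ψ := by rw [← Matrix.map_mul, h]

theorem map_mul_eq' (x : Matrix N' N W) {a : Matrix N N W} (h : x * a = x) :
    x.map ψ * a.map ψ = x.map ψ := by rw [← Matrix.map_mul, h]

variable (s : Splitting idx (w.E.map ψ)) (s₁ : Splitting idx (w.E.map (ψ.comp φ)))
  (s' : Splitting idx' (w'.E.map ψ)) (s₁' : Splitting idx' (w'.E.map (ψ.comp φ)))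

/-- The matrix of `Ψ` in local bases. -/
def locΨ : Matrix H H S := s.B * w.Ψ.map ψ * s₁.A

/-- The matrix of `Ψi` in local bases. -/
def locΨi : Matrix H H S := s₁.B * w.Ψi.map ψ * s.A

theorem A_mul_locΨ_mul : s.A * locΨ s s₁ * s₁.B = w.Ψ.map ψ :=
  s.mul_mul_eq s₁ _ (map_mul_eq _ w.E_mul_Ψ) (map_mul_eq' (ψ := ψ) _ w.Ψ_mul_E)

theorem A_mul_locΨi_mul : s₁.A * locΨi s s₁ * s.B = w.Ψi.map ψ :=
  s₁.mul_mul_eq s _ (map_mul_eq (ψ := ψ) _ w.E_mul_Ψi) (map_mul_eq' (ψ := ψ) _ w.Ψi_mul_E)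

theorem locΨ_mul_locΨi : locΨ s s₁ * locΨi s s₁ = 1 := by
  calc _ = s.B * w.Ψ.map ψ * (s₁.A * s₁.B * w.Ψi.map ψ) * s.A := by
        simp only [locΨ, locΨi, Matrix.mul_assoc]
    _ = s.B * (w.Ψ.map ψ * w.Ψi.map ψ) * s.A := by
        have h : w.E.map (ψ.comp φ) * w.Ψi.map ψ = w.Ψi.map ψ := map_mul_eq (ψ := ψ) _ w.E_mul_Ψi
        rw [s₁.mul_eq, h, Matrix.mul_assoc s.B]
    _ = _ := by
        rw [← Matrix.map_mul, w.Ψ_mul, s.mul_E_mul]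

/-- The factor by which the determinants of `u` and `φ(u)` in local bases differ. -/
def ε : S := (locΨ s' s₁').det * (locΨi s s₁).det

theorem isUnit_ε : IsUnit (ε s s₁ s' s₁') := by
  have h := congrArg Matrix.det (locΨ_mul_locΨi s s₁)
  have h' := congrArg Matrix.det (locΨ_mul_locΨi s' s₁')
  rw [Matrix.det_mul, Matrix.det_one] at h h'
  exact (IsUnit.of_mul_eq_one _ h').mul (IsUnit.of_mul_eq_one_right _ h)

theorem map_det_submatrix {n : Type*} [Fintype n] [DecidableEq n] (x : Matrix N' N W)
    (f : n → N') (g : n → N) : ψ (x.submatrix f g).det = ((x.map ψ).submatrix f g).det :=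
  RingHom.map_det ψ _

/-- Locally the transition matrix has the rank one form `θ ε ρᵀ`, where `ρ` is dual to the vector
`θ₁` for `ψ ∘ φ`. Hence it sends `θ₁ y` to `θ ε y`. -/
theorem exists_transition (hw' : w'.IsSplit idx') (hw : w.IsSplit idx) :
    ∃ ρ : 𝒜' × 𝒜 → S, ∑ k, ρ k * Splitting.θ s₁' s₁ k = 1 ∧
      ∀ k l, ψ (transition hw' hw k l) = Splitting.θ s' s k * ε s s₁ s' s₁' * ρ l := by
  refine ⟨fun l => (∑ β', s₁'.b β' * ψ (φ (hw'.c (l.1, β')))) *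
    ∑ β, ψ (φ (hw.c (β, l.2))) * s₁.a β, ?_, fun k l => ?_⟩
  · have h' := congrArg (ψ.comp φ) hw'.sum_c
    have h := congrArg (ψ.comp φ) hw.sum_c
    simp only [map_sum, map_mul, map_one, map_det_submatrix, s₁'.det_submatrix_self,
      s₁.det_submatrix_self, Fintype.sum_prod_type] at h h'
    rw [Finset.sum_comm] at h
    rw [← mul_one 1]
    nth_rewrite 2 [← h]
    rw [← h', Finset.sum_mul_sum, Fintype.sum_prod_type]
    refine Finset.sum_congr rfl fun γ' _ => Finset.sum_congr rfl fun γ _ => ?_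
    have e1 : ∑ β', (ψ.comp φ) (hw'.c (γ', β')) * (s₁'.a γ' * s₁'.b β') =
        s₁'.a γ' * ∑ β', s₁'.b β' * ψ (φ (hw'.c (γ', β'))) := by
      rw [Finset.mul_sum]
      exact Finset.sum_congr rfl fun _ _ => by simp only [RingHom.comp_apply]; ring
    have e2 : ∑ β, (ψ.comp φ) (hw.c (β, γ)) * (s₁.a β * s₁.b γ) =
        s₁.b γ * ∑ β, ψ (φ (hw.c (β, γ))) * s₁.a β := by
      rw [Finset.mul_sum]
      exact Finset.sum_congr rfl fun _ _ => by simp only [RingHom.comp_apply]; ring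
    rw [e1, e2, Splitting.θ]
    ring
  · have h1 : ∀ β', ψ (w'.Ψ.submatrix (idx' k.1) (idx' β')).det =
        s'.a k.1 * (locΨ s' s₁').det * s₁'.b β' := fun β' => by
      rw [map_det_submatrix, ← A_mul_locΨ_mul s' s₁', Splitting.det_submatrix_mul]
    have h2 : ∀ β, ψ (w.Ψi.submatrix (idx β) (idx k.2)).det =
        s₁.a β * (locΨi s s₁).det * s.b k.2 := fun β => by
      rw [map_det_submatrix, ← A_mul_locΨi_mul s s₁, Splitting.det_submatrix_mul]
    simp only [transition, Matrix.of_apply, map_mul, map_sum, h1, h2, ε, Splitting.θ]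
    have h3 : ∑ β', s'.a k.1 * (locΨ s' s₁').det * s₁'.b β' * ψ (φ (hw'.c (l.1, β'))) =
        s'.a k.1 * (locΨ s' s₁').det * ∑ β', s₁'.b β' * ψ (φ (hw'.c (l.1, β'))) := by
      rw [Finset.mul_sum]
      exact Finset.sum_congr rfl fun _ _ => by ring
    have h4 : ∑ β, ψ (φ (hw.c (β, l.2))) * (s₁.a β * (locΨi s s₁).det * s.b k.2) =
        s.b k.2 * (locΨi s s₁).det * ∑ β, ψ (φ (hw.c (β, l.2))) * s₁.a β := by
      rw [Finset.mul_sum]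
      exact Finset.sum_congr rfl fun _ _ => by ring
    rw [h3, h4]
    ring

/-- A solution of `u = C φ(u)` is in local bases a solution of `u = ε φ(u)`. -/
theorem exists_local_of_eq_transition (hw' : w'.IsSplit idx') (hw : w.IsSplit idx)
    (u : 𝒜' × 𝒜 → W) (hu : u = (transition hw' hw).mulVec (φ ∘ u))
    (s₂ : Splitting idx (w.E.map ((ψ.comp φ).comp φ)))
    (s₂' : Splitting idx' (w'.E.map ((ψ.comp φ).comp φ))) :
    ∃ x y : S, (∀ k, ψ (u k) = Splitting.θ s' s k * x) ∧
      (∀ k, ψ (φ (u k)) = Splitting.θ s₁' s₁ k * y) ∧ x = ε s s₁ s' s₁' * y := by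
  -- The argument is run for `ψ` and again for `ψ ∘ φ`; the second run is what requires splittings
  -- over `ψ ∘ φ ∘ φ`.
  have key : ∀ (ψ : W →+* S) (s : Splitting idx (w.E.map ψ))
      (s₁ : Splitting idx (w.E.map (ψ.comp φ))) (s' : Splitting idx' (w'.E.map ψ))
      (s₁' : Splitting idx' (w'.E.map (ψ.comp φ))), ∃ ρ : 𝒜' × 𝒜 → S,
      ∑ k, ρ k * Splitting.θ s₁' s₁ k = 1 ∧ ∀ k, ψ (u k) =
        Splitting.θ s' s k * (ε s s₁ s' s₁' * ∑ l, ρ l * ψ (φ (u l))) := by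
    intro ψ s s₁ s' s₁'
    obtain ⟨ρ, hρ, h⟩ := exists_transition s s₁ s' s₁' hw' hw
    refine ⟨ρ, hρ, fun k => ?_⟩
    conv_lhs => rw [hu]
    simp only [Matrix.mulVec, dotProduct, map_sum, map_mul, h, Function.comp, Finset.mul_sum]
    exact Finset.sum_congr rfl fun _ _ => by ring
  obtain ⟨ρ, hρ, h⟩ := key ψ s s₁ s' s₁'
  obtain ⟨ρ₁, -, h₁⟩ := key (ψ.comp φ) s₁ s₂ s₁' s₂'
  refine ⟨_, _, h, h₁, ?_⟩
  congr 1
  rw [← one_mul (ε _ _ _ _ * _), ← hρ, Finset.sum_mul]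
  exact Finset.sum_congr rfl fun l _ => by
    rw [mul_assoc, ← h₁ l]
    rfl

end Local

theorem eq_of_localization {x y : W} (h : ∀ (𝔮 : Ideal W) [𝔮.IsMaximal],
    algebraMap W (Localization.AtPrime 𝔮) x = algebraMap W (Localization.AtPrime 𝔮) y) : x = y := by
  rw [← sub_eq_zero]
  refine eq_zero_of_localization _ fun 𝔮 _ => ?_
  rw [map_sub, h, sub_self]

theorem matrix_eq_of_localization {m n : Type*} {x y : Matrix m n W}
    (h : ∀ (𝔮 : Ideal W) [𝔮.IsMaximal], x.map (algebraMap W (Localization.AtPrime 𝔮)) =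
      y.map (algebraMap W (Localization.AtPrime 𝔮))) : x = y := by
  ext i j
  exact eq_of_localization fun 𝔮 _ => congrFun (congrFun (h 𝔮) i) j

/-- The minors of a matrix. -/
def minors (idx' : 𝒜' → H → N') (idx : 𝒜 → H → N) (f : Matrix N' N W) (k : 𝒜' × 𝒜) : W :=
  (f.submatrix (idx' k.1) (idx k.2)).det

/-- A morphism `f : w → w'` together with its twist `g : φ(w) → φ(w')`. -/
structure IsHom (w : MatrixWindow φ N) (w' : MatrixWindow φ N') (f g : Matrix N' N W) : Prop where
  E_mul : w'.E * f = f
  mul_E : f * w.E = f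
  E_mul' : w'.E.map φ * g = g
  mul_E' : g * w.E.map φ = g
  comm : w'.Ψ * g = f * w.Ψ

namespace IsHom

variable {f g : Matrix N' N W}

theorem eq_mul_mul (hf : IsHom w w' f g) : f = w'.Ψ * g * w.Ψi := by
  rw [hf.comm, Matrix.mul_assoc, w.Ψ_mul, hf.mul_E]

theorem loc_eq (hf : IsHom w w' f g) {S : Type u} [CommRing S] {ψ : W →+* S}
    (s : Splitting idx (w.E.map ψ)) (s₁ : Splitting idx (w.E.map (ψ.comp φ)))
    (s' : Splitting idx' (w'.E.map ψ)) (s₁' : Splitting idx' (w'.E.map (ψ.comp φ))) :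
    s'.B * f.map ψ * s.A = locΨ s' s₁' * (s₁'.B * g.map ψ * s₁.A) * locΨi s s₁ := by
  have h1 : s₁'.A * (s₁'.B * g.map ψ * s₁.A) * s₁.B = g.map ψ :=
    s₁'.mul_mul_eq s₁ _ (map_mul_eq (ψ := ψ) _ hf.E_mul') (map_mul_eq' (ψ := ψ) _ hf.mul_E')
  conv_lhs => rw [hf.eq_mul_mul, Matrix.map_mul, Matrix.map_mul, ← h1]
  simp only [locΨ, locΨi, Matrix.mul_assoc]

/-- Locally the minors of `f` are `θ · det f` and those of `g` are `θ₁ · det g`. Since `f = Ψ' g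
Ψ⁻¹`, the two determinants differ by the unit `ε`, as the local form of the transition matrix
requires. -/
theorem minors_eq (hf : IsHom w w' f g) (hw' : w'.IsSplit idx') (hw : w.IsSplit idx)
    (hfg : ∀ k, minors idx' idx g k = φ (minors idx' idx f k)) :
    minors idx' idx f = (transition hw' hw).mulVec (φ ∘ minors idx' idx f) := by
  funext k
  refine eq_of_localization fun 𝔮 _ => ?_
  set ψ := algebraMap W (Localization.AtPrime 𝔮)
  obtain ⟨s⟩ := hw _ ψ
  obtain ⟨s₁⟩ := hw _ (ψ.comp φ)
  obtain ⟨s'⟩ := hw' _ ψ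
  obtain ⟨s₁'⟩ := hw' _ (ψ.comp φ)
  obtain ⟨ρ, hρ, h⟩ := exists_transition s s₁ s' s₁' hw' hw
  have h1 : ∀ l, ψ (φ (minors idx' idx f l)) =
      Splitting.θ s₁' s₁ l * (s₁'.B * g.map ψ * s₁.A).det := fun l => by
    rw [← hfg, minors, map_det_submatrix, s₁'.det_submatrix s₁ _
      (map_mul_eq (ψ := ψ) _ hf.E_mul') (map_mul_eq' (ψ := ψ) _ hf.mul_E'), Splitting.θ]
    ring
  simp only [Matrix.mulVec, dotProduct, map_sum, map_mul, h, Function.comp, h1]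
  rw [minors, map_det_submatrix, s'.det_submatrix s _
      (map_mul_eq (ψ := ψ) _ hf.E_mul) (map_mul_eq' (ψ := ψ) _ hf.mul_E),
      hf.loc_eq s s₁ s' s₁', Matrix.det_mul, Matrix.det_mul, ← mul_one (_ * _ * s.b _), ← hρ,
      Finset.mul_sum]
  refine Finset.sum_congr rfl fun l _ => ?_
  simp only [ε, Splitting.θ]
  ring

end IsHom

/-- If `u = C φ(u)` vanishes in a residue field, then so does `φ(u)`. -/
theorem map_frob_eq_zero (hw' : w'.IsSplit idx') (hw : w.IsSplit idx)
    (u : 𝒜' × 𝒜 → W) (hu : u = (transition hw' hw).mulVec (φ ∘ u))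
    {S : Type u} [CommRing S] [IsLocalRing S] (ψ : W →+* S) (h : ∀ k, ψ (u k) = 0) (k : 𝒜' × 𝒜) :
    ψ (φ (u k)) = 0 := by
  obtain ⟨s⟩ := hw _ ψ
  obtain ⟨s₁⟩ := hw _ (ψ.comp φ)
  obtain ⟨s₂⟩ := hw _ ((ψ.comp φ).comp φ)
  obtain ⟨s'⟩ := hw' _ ψ
  obtain ⟨s₁'⟩ := hw' _ (ψ.comp φ)
  obtain ⟨s₂'⟩ := hw' _ ((ψ.comp φ).comp φ)
  obtain ⟨x, y, hx, hy, hxy⟩ := exists_local_of_eq_transition s s₁ s' s₁' hw' hw u hu s₂ s₂'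
  have hx0 : x = 0 := s'.eq_of_θ s fun k => by rw [← hx, h, mul_zero]
  have hy0 : y = 0 := (isUnit_ε s s₁ s' s₁').mul_left_cancel (by rw [← hxy, hx0, mul_zero])
  rw [hy, hy0, mul_zero]

/-- The sum over all `k = (α', α)` of `η k • E_α adj(f_{α', α}) E'_{α'}`. -/
def adj (idx' : 𝒜' → H → N') (idx : 𝒜 → H → N) (E : Matrix N N W) (E' : Matrix N' N' W)
    (η : 𝒜' × 𝒜 → W) (f : Matrix N' N W) : Matrix N N' W :=
  ∑ k, η k • (E.submatrix id (idx k.2) * (f.submatrix (idx' k.1) (idx k.2)).adjugate *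
    E'.submatrix (idx' k.1) id)

theorem map_adj {S : Type*} [CommRing S] (ψ : W →+* S) (E : Matrix N N W) (E' : Matrix N' N' W)
    (η : 𝒜' × 𝒜 → W) (f : Matrix N' N W) :
    (adj idx' idx E E' η f).map ψ =
      adj idx' idx (E.map ψ) (E'.map ψ) (ψ ∘ η) (f.map ψ) := by
  rw [adj, adj, ← AddMonoidHom.coe_coe, ← AddMonoidHom.mapMatrix_apply, map_sum]
  refine Finset.sum_congr rfl fun k _ => ?_
  rw [AddMonoidHom.mapMatrix_apply, AddMonoidHom.coe_coe]
  refine (Matrix.map_smulₛₗ ψ ψ (η k) (fun _ => map_mul ψ _ _) _).trans ?_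
  rw [Matrix.map_mul, Matrix.map_mul]
  have : (f.submatrix (idx' k.1) (idx k.2)).adjugate.map ψ =
      ((f.map ψ).submatrix (idx' k.1) (idx k.2)).adjugate := RingHom.map_adjugate ψ _
  rw [this]
  rfl

/-- Each submatrix of `f` factors as (rows of `A'`) · (local matrix) · (columns of `B`). In the
reversed product of adjugates the outer factors combine to the minors `b` and `a'`, so every summand
is a multiple of one matrix. This makes the local adjugates glue. -/
theorem adj_eq {S : Type*} [CommRing S] {E : Matrix N N S} {E' : Matrix N' N' S}
    (s : Splitting idx E) (s' : Splitting idx' E') (η : 𝒜' × 𝒜 → S) (f : Matrix N' N S)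
    (hf' : E' * f = f) (hf : f * E = f) :
    adj idx' idx E E' η f =
      (∑ k, η k * Splitting.θ s' s k) • (s.A * (s'.B * f * s.A).adjugate * s'.B) := by
  rw [adj, Finset.sum_smul]
  refine Finset.sum_congr rfl fun k _ => ?_
  rw [mul_smul]
  congr 1
  have h1 : f.submatrix (idx' k.1) (idx k.2) =
      s'.A.submatrix (idx' k.1) id * (s'.B * f * s.A) * s.B.submatrix id (idx k.2) := by
    conv_lhs => rw [← s'.mul_mul_eq s f hf' hf]
    rw [Matrix.submatrix_mul _ _ _ id _ Function.bijective_id,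
      Matrix.submatrix_mul _ _ _ id _ Function.bijective_id, Matrix.submatrix_id_id]
  have h2 : E.submatrix id (idx k.2) = s.A * s.B.submatrix id (idx k.2) := by
    conv_lhs => rw [← s.mul_eq, Matrix.submatrix_mul _ _ _ id _ Function.bijective_id,
      Matrix.submatrix_id_id]
  have h3 : E'.submatrix (idx' k.1) id = s'.A.submatrix (idx' k.1) id * s'.B := by
    conv_lhs => rw [← s'.mul_eq, Matrix.submatrix_mul _ _ _ id _ Function.bijective_id,
      Matrix.submatrix_id_id]
  rw [h1, h2, h3, Matrix.adjugate_mul_distrib, Matrix.adjugate_mul_distrib]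
  calc _ = s.A * (s.B.submatrix id (idx k.2) * (s.B.submatrix id (idx k.2)).adjugate) *
        (s'.B * f * s.A).adjugate * ((s'.A.submatrix (idx' k.1) id).adjugate *
          s'.A.submatrix (idx' k.1) id) * s'.B := by simp only [Matrix.mul_assoc]
    _ = _ := by
      rw [Matrix.mul_adjugate, Matrix.adjugate_mul]
      simp only [Matrix.mul_smul, Matrix.smul_mul, Matrix.mul_one, smul_smul, Splitting.θ,
        Splitting.a, Splitting.b]

/-- Let `f : w → w'` be a morphism with minors `q u`, where `u = C φ(u)` generates the unit ideal.
Then `adj η f`, for suitable `η`, is a morphism `w' → w` whose composition with `f` is `q`. -/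
theorem IsHom.adj_comm_and_adj_mul {f g : Matrix N' N W} (hf : IsHom w w' f g) (hw' : w'.IsSplit idx')
    (hw : w.IsSplit idx) (q : W) (u : 𝒜' × 𝒜 → W)
    (hu : u = (transition hw' hw).mulVec (φ ∘ u)) (hq : ∀ k, minors idx' idx f k = q * u k)
    (η : 𝒜' × 𝒜 → W) (hη : ∑ k, η k * u k = 1) :
    w.Ψ * adj idx' idx (w.E.map φ) (w'.E.map φ) (φ ∘ η) g = adj idx' idx w.E w'.E η f * w'.Ψ ∧
      adj idx' idx w.E w'.E η f * f = q • w.E := by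
  rw [← and_comm]
  constructor
  all_goals
    refine matrix_eq_of_localization fun 𝔮 _ => ?_
    set ψ := algebraMap W (Localization.AtPrime 𝔮)
    obtain ⟨s⟩ := hw _ ψ
    obtain ⟨s₁⟩ := hw _ (ψ.comp φ)
    obtain ⟨s₂⟩ := hw _ ((ψ.comp φ).comp φ)
    obtain ⟨s'⟩ := hw' _ ψ
    obtain ⟨s₁'⟩ := hw' _ (ψ.comp φ)
    obtain ⟨s₂'⟩ := hw' _ ((ψ.comp φ).comp φ)
    obtain ⟨x, y, hx, hy, hxy⟩ := exists_local_of_eq_transition s s₁ s' s₁' hw' hw u hu s₂ s₂'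
    -- In local bases `u` is `θ x`, so the relation `hη` makes `∑ η θ` the inverse of `x`; `hηy` is
    -- the same over `ψ ∘ φ`.
    have hηx : (∑ k, ψ (η k) * Splitting.θ s' s k) * x = 1 := by
      have := congrArg ψ hη
      simp only [map_sum, map_mul, map_one, hx] at this
      rw [← this, Finset.sum_mul]
      exact Finset.sum_congr rfl fun _ _ => by ring
    have hηy : (∑ k, ψ (φ (η k)) * Splitting.θ s₁' s₁ k) * y = 1 := by
      have := congrArg (fun x => ψ (φ x)) hη
      simp only [map_sum, map_mul, map_one, hy] at this
      rw [← this, Finset.sum_mul]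
      exact Finset.sum_congr rfl fun _ _ => by ring
    have hfE := map_mul_eq (ψ := ψ) _ hf.E_mul
    have hfE' := map_mul_eq' (ψ := ψ) _ hf.mul_E
    have e1 : (adj idx' idx w.E w'.E η f).map ψ = _ :=
      (map_adj ψ w.E w'.E η f).trans (adj_eq s s' (ψ ∘ η) (f.map ψ) hfE hfE')
    rw [Matrix.map_mul]
  · have hdet : (s'.B * f.map ψ * s.A).det = ψ q * x := s'.eq_of_θ s fun k => by
      have h1 := congrArg ψ (hq k)
      rw [minors, map_det_submatrix, s'.det_submatrix s _ hfE hfE', map_mul, hx] at h1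
      rw [Splitting.θ] at h1 ⊢
      linear_combination h1
    have hmul : s'.A * (s'.B * (f.map ψ * (s.A * s.B))) = f.map ψ := by
      conv_rhs => rw [← s'.mul_mul_eq s (f.map ψ) hfE hfE']
      simp only [Matrix.mul_assoc]
    rw [e1, Matrix.smul_mul]
    calc _ = (∑ k, ψ (η k) * Splitting.θ s' s k) • (s.A * ((s'.B * f.map ψ * s.A).adjugate *
          (s'.B * s'.A) * (s'.B * f.map ψ * s.A)) * s.B) := by
            simp only [Matrix.mul_assoc, Function.comp, hmul]
      _ = ψ q • (s.A * s.B) := by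
            rw [s'.mul_eq_one, Matrix.mul_one, Matrix.adjugate_mul, hdet]
            simp only [Matrix.mul_smul, Matrix.smul_mul, Matrix.mul_one, smul_smul]
            congr 1
            linear_combination ψ q * hηx
      _ = _ := by
            rw [s.mul_eq]
            ext i j
            simp
  · have hgE : w'.E.map (ψ.comp φ) * g.map ψ = g.map ψ := map_mul_eq (ψ := ψ) _ hf.E_mul'
    have hgE' : g.map ψ * w.E.map (ψ.comp φ) = g.map ψ := map_mul_eq' (ψ := ψ) _ hf.mul_E'
    have e2 : (adj idx' idx (w.E.map φ) (w'.E.map φ) (φ ∘ η) g).map ψ = _ :=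
      (map_adj ψ (w.E.map φ) (w'.E.map φ) (φ ∘ η) g).trans
        (adj_eq s₁ s₁' (ψ ∘ φ ∘ η) (g.map ψ) hgE hgE')
    rw [e2, Matrix.map_mul, e1, ← A_mul_locΨ_mul s s₁, ← A_mul_locΨ_mul s' s₁',
      hf.loc_eq s s₁ s' s₁']
    have h1 : locΨ s s₁ * locΨi s s₁ = 1 := locΨ_mul_locΨi s s₁
    -- `locΨ` inverts `locΨi`, so the adjugate of the latter is its determinant times the former.
    have h2 : (locΨi s s₁).adjugate = (locΨi s s₁).det • locΨ s s₁ := by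
      rw [← Matrix.one_mul (locΨi s s₁).adjugate, ← h1, Matrix.mul_assoc, Matrix.mul_adjugate,
        Matrix.mul_smul, Matrix.mul_one]
    rw [Matrix.adjugate_mul_distrib, Matrix.adjugate_mul_distrib, h2]
    set G := (s₁'.B * g.map ψ * s₁.A).adjugate
    -- The sums are the inverses of `y` and of `x = ε y`.
    have h3 : ∑ k, ψ (φ (η k)) * Splitting.θ s₁' s₁ k =
        (∑ k, ψ (η k) * Splitting.θ s' s k) * ε s s₁ s' s₁' := by
      rw [hxy] at hηx
      linear_combination -(∑ k, ψ (φ (η k)) * Splitting.θ s₁' s₁ k) * hηx +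
        (∑ k, ψ (η k) * Splitting.θ s' s k) * ε s s₁ s' s₁' * hηy
    calc _ = (∑ k, ψ (φ (η k)) * Splitting.θ s₁' s₁ k) •
          (s.A * locΨ s s₁ * (s₁.B * s₁.A) * G * s₁'.B) := by
            simp only [Matrix.mul_smul, Matrix.mul_assoc, Function.comp]
      _ = (∑ k, ψ (η k) * Splitting.θ s' s k) • (s.A * ((locΨi s s₁).det • locΨ s s₁ * (G *
          ((locΨ s' s₁').adjugate * (s'.B * s'.A) * locΨ s' s₁'))) * s₁'.B) := by
            rw [h3, s₁.mul_eq_one, s'.mul_eq_one, Matrix.mul_one, Matrix.mul_one,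
              Matrix.adjugate_mul]
            simp only [Matrix.mul_smul, Matrix.smul_mul, Matrix.mul_one, smul_smul, ε,
              Matrix.mul_assoc]
      _ = _ := by
            simp only [Matrix.smul_mul, Matrix.mul_assoc, Function.comp]

end MatrixWindow

end Window


/-! ### Coordinates on projective modules -/

section Coordinates

variable {W : Type u} [CommRing W]

/-- A presentation of `M` as a direct summand of a free module. -/
structure Coordinates (W : Type u) [CommRing W] (n : Type*) [Fintype n] (M : Type*)
    [AddCommGroup M] [Module W M] where
  i : M →ₗ[W] (n → W)
  q : (n → W) →ₗ[W] M
  q_i : ∀ x, q (i x) = x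

namespace Coordinates

variable {n n' : Type*} [Fintype n] [DecidableEq n] [Fintype n'] [DecidableEq n']
  {M M' : Type*} [AddCommGroup M] [Module W M] [AddCommGroup M'] [Module W M']
  {S : Type u} [CommRing S]

theorem exists_of_projective (M : Type*) [AddCommGroup M] [Module W M] [Module.Finite W M]
    [Module.Projective W M] : ∃ n : ℕ, Nonempty (Coordinates W (Fin n) M) := by
  obtain ⟨n, q, i, -, -, h⟩ := Module.Finite.exists_comp_eq_id_of_projective W M
  exact ⟨n, ⟨⟨i, q, LinearMap.congr_fun h⟩⟩⟩

variable (c : Coordinates W n M) (c' : Coordinates W n' M') (ψ : W →+* S)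

/-- The generators of `M`. -/
def gen (j : n) : M := c.q (Pi.single j 1)

/-- The matrix of a linear map. -/
def mat (f : M →ₗ[W] M') : Matrix n' n W := .of fun i j => c'.i (f (c.gen j)) i

theorem mat_apply (f : M →ₗ[W] M') (i : n') (j : n) : mat c c' f i j = c'.i (f (c.gen j)) i := rfl

/-- The idempotent matrix with image `M`. -/
def E : Matrix n n W := mat c c LinearMap.id

/-- The coordinates on a base change of `M`. -/
def iBC : BaseChange ψ M →ₗ[S] (n → S) :=
  BaseChange.linearize ψ
    { toFun := fun x j => ψ (c.i x j)
      map_add' := fun x y => by ext j; simp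
      map_smul' := fun a x => by ext j; simp }

/-- The projection from a free module onto a base change of `M`. -/
def qBC : (n → S) →ₗ[S] BaseChange ψ M :=
  Fintype.linearCombination S fun j => BaseChange.mk ψ (c.gen j)

theorem sum_smul_gen (x : M) : ∑ j, c.i x j • c.gen j = x := by
  conv_rhs => rw [← c.q_i x, pi_eq_sum_univ' (c.i x), map_sum]
  exact Finset.sum_congr rfl fun j _ => by rw [map_smul, gen]

@[simp]
theorem iBC_mk (x : M) (j : n) : c.iBC ψ (BaseChange.mk ψ x) j = ψ (c.i x j) := by
  rw [iBC, BaseChange.linearize_mk]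
  rfl

theorem tmul_eq_smul_mk (b : S) (x : M) : BaseChange.tmul ψ b x = b • BaseChange.mk ψ x := by
  change _ = b • BaseChange.tmul ψ 1 x
  rw [BaseChange.smul_tmul, mul_one]

theorem qBC_apply (v : n → S) : c.qBC ψ v = ∑ j, v j • BaseChange.mk ψ (c.gen j) :=
  Fintype.linearCombination_apply _ _ _

@[simp]
theorem qBC_iBC (z : BaseChange ψ M) : c.qBC ψ (c.iBC ψ z) = z := by
  induction z using BaseChange.induction with
  | zero => simp only [map_zero]
  | tmul b x =>
    rw [tmul_eq_smul_mk, map_smul, map_smul, qBC_apply]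
    conv_rhs => rw [← c.sum_smul_gen x, map_sum]
    congr 1
    exact Finset.sum_congr rfl fun j _ => by rw [iBC_mk, LinearMap.map_smulₛₗ]
  | add x y hx hy => rw [map_add, map_add, hx, hy]

theorem iBC_qBC (v : n → S) : c.iBC ψ (c.qBC ψ v) = ((E c).map ψ).mulVec v := by
  funext i
  rw [qBC_apply, map_sum, Finset.sum_apply]
  refine Finset.sum_congr rfl fun j _ => ?_
  rw [map_smul, Pi.smul_apply, iBC_mk, smul_eq_mul, mul_comm]
  rfl

theorem iBC_map (f : M →ₗ[W] M') (z : BaseChange ψ M) :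
    c'.iBC ψ (BaseChange.map ψ f z) = ((mat c c' f).map ψ).mulVec (c.iBC ψ z) := by
  conv_lhs => rw [← c.qBC_iBC ψ z, qBC_apply, map_sum, map_sum]
  funext i
  rw [Finset.sum_apply]
  refine Finset.sum_congr rfl fun j _ => ?_
  have h : BaseChange.map ψ f (BaseChange.mk ψ (c.gen j)) = BaseChange.mk ψ (f (c.gen j)) :=
    BaseChange.map_tmul ψ f 1 _
  rw [map_smul, map_smul, h, Pi.smul_apply, iBC_mk, smul_eq_mul, mul_comm]
  rfl

theorem mulVec_i (f : M →ₗ[W] M') (x : M) : (mat c c' f).mulVec (c.i x) = c'.i (f x) := by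
  funext i
  conv_rhs => rw [← c.sum_smul_gen x, map_sum, map_sum, Finset.sum_apply]
  refine Finset.sum_congr rfl fun j _ => ?_
  rw [map_smul, map_smul, Pi.smul_apply, smul_eq_mul, mul_comm]
  rfl

theorem mat_comp {n'' : Type*} [Fintype n''] [DecidableEq n''] {M'' : Type*} [AddCommGroup M''] [Module W M'']
    (c'' : Coordinates W n'' M'') (f : M →ₗ[W] M') (g : M' →ₗ[W] M'') :
    mat c c'' (g ∘ₗ f) = mat c' c'' g * mat c c' f := by
  ext i j
  have := congrFun (mulVec_i c' c'' g (f (c.gen j))) i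
  exact this.symm

theorem mat_mul_E (f : M →ₗ[W] M') : mat c c' f * c.E = mat c c' f :=
  (mat_comp c c c' LinearMap.id f).symm

theorem E_mul_mat (f : M →ₗ[W] M') : c'.E * mat c c' f = mat c c' f :=
  (mat_comp c c' c' f LinearMap.id).symm

theorem i_injective : Function.Injective c.i := fun x y h => by rw [← c.q_i x, h, c.q_i]

theorem mat_injective : Function.Injective (mat c c') := fun f g h => by
  ext x
  apply c'.i_injective
  rw [← mulVec_i c c' f, h, mulVec_i]

/-- Coordinates on a base change. -/
def baseChange : Coordinates S n (BaseChange ψ M) := ⟨c.iBC ψ, c.qBC ψ, c.qBC_iBC ψ⟩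

theorem gen_baseChange (j : n) : (c.baseChange ψ).gen j = BaseChange.mk ψ (c.gen j) := by
  refine (c.qBC_apply ψ _).trans ?_
  rw [Finset.sum_eq_single j (fun k _ hk => by rw [Pi.single_eq_of_ne hk, zero_smul])
    (fun h => absurd (Finset.mem_univ j) h), Pi.single_eq_same, one_smul]

theorem E_baseChange : (c.baseChange ψ).E = c.E.map ψ := by
  ext i j
  rw [E, mat, Matrix.of_apply, LinearMap.id_apply, gen_baseChange]
  exact c.iBC_mk ψ _ i

/-- The linear map with a given matrix. -/
def ofMat (G : Matrix n' n W) : M →ₗ[W] M' := c'.q.comp ((Matrix.mulVecLin G).comp c.i)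

theorem mat_ofMat (G : Matrix n' n W) : mat c c' (ofMat c c' G) = c'.E * G * c.E := by
  have h : ∀ v, c'.i (c'.q v) = c'.E.mulVec v := fun v => by
    conv_lhs => rw [pi_eq_sum_univ' v, map_sum, map_sum]
    funext i
    rw [Finset.sum_apply]
    refine Finset.sum_congr rfl fun j _ => ?_
    rw [map_smul, map_smul, Pi.smul_apply, smul_eq_mul, mul_comm]
    rfl
  ext i j
  refine (congrFun (h _) i).trans ?_
  rw [LinearMap.comp_apply, Matrix.mulVecLin_apply, Matrix.mulVec_mulVec]
  rfl

/-- Coordinates on a product. -/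
def prod : Coordinates W (n ⊕ n') (M × M') where
  i :=
    { toFun := fun x => Sum.elim (c.i x.1) (c'.i x.2)
      map_add' := fun x y => by ext (j | j) <;> simp
      map_smul' := fun a x => by ext (j | j) <;> simp }
  q :=
    { toFun := fun v => (c.q (v ∘ Sum.inl), c'.q (v ∘ Sum.inr))
      map_add' := fun x y => by
        ext1
        · exact map_add c.q (x ∘ Sum.inl) (y ∘ Sum.inl)
        · exact map_add c'.q (x ∘ Sum.inr) (y ∘ Sum.inr)
      map_smul' := fun a x => by
        ext1
        · exact map_smul c.q a (x ∘ Sum.inl)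
        · exact map_smul c'.q a (x ∘ Sum.inr) }
  q_i x := by
    ext1
    · exact c.q_i x.1
    · exact c'.q_i x.2

theorem prod_gen_inl (j : n) : (c.prod c').gen (.inl j) = (c.gen j, 0) := by
  ext1
  · refine congrArg c.q (funext fun k => ?_)
    simp [Pi.single_apply, Sum.inl_injective.eq_iff]
  · refine (congrArg c'.q (funext fun k => ?_)).trans (map_zero c'.q)
    simp

theorem prod_gen_inr (j : n') : (c.prod c').gen (.inr j) = (0, c'.gen j) := by
  ext1
  · refine (congrArg c.q (funext fun k => ?_)).trans (map_zero c.q)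
    simp
  · refine congrArg c'.q (funext fun k => ?_)
    simp [Pi.single_apply, Sum.inr_injective.eq_iff]

theorem E_prod : (c.prod c').E = Matrix.fromBlocks c.E 0 0 c'.E := by
  ext (i | i) (j | j)
  · simp only [E, mat, Matrix.of_apply, prod_gen_inl, LinearMap.id_apply]; rfl
  · simp only [E, mat, Matrix.of_apply, prod_gen_inr, LinearMap.id_apply]
    exact congrFun (map_zero c.i) i
  · simp only [E, mat, Matrix.of_apply, prod_gen_inl, LinearMap.id_apply]
    exact congrFun (map_zero c'.i) i
  · simp only [E, mat, Matrix.of_apply, prod_gen_inr, LinearMap.id_apply]; rfl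

/-! #### Splittings -/

theorem exists_basis [Module.Finite W M] [Module.Projective W M] (d : ℕ)
    (hd : ∀ x : PrimeSpectrum W, Module.rankAtStalk M x = d) [IsLocalRing S] :
    Nonempty (Module.Basis (Fin d) S (BaseChange ψ M)) := by
  have h0 : IsLocalRing (AlongHom ψ) := inferInstanceAs (IsLocalRing S)
  have h1 : Module.Free (AlongHom ψ) (AlongHom ψ ⊗[W] M) := Module.free_of_flat_of_isLocalRing
  have h2 : Module.Finite (AlongHom ψ) (AlongHom ψ ⊗[W] M) := inferInstance
  have h3 : Module.finrank (AlongHom ψ) (AlongHom ψ ⊗[W] M) = d := by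
    have h4 := Module.rankAtStalk_baseChange (R := W) (M := M) (S := AlongHom ψ)
      (IsLocalRing.closedPoint _)
    rw [hd, Module.rankAtStalk_eq_finrank_of_free] at h4
    exact h4
  exact ⟨(Module.finBasisOfFinrankEq (AlongHom ψ) (AlongHom ψ ⊗[W] M) h3 :)⟩

theorem exists_factorization [Module.Finite W M] [Module.Projective W M] (d : ℕ)
    (hd : ∀ x : PrimeSpectrum W, Module.rankAtStalk M x = d) [IsLocalRing S] :
    ∃ (A : Matrix n (Fin d) S) (B : Matrix (Fin d) n S), A * B = c.E.map ψ ∧ B * A = 1 := by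
  obtain ⟨b⟩ := exists_basis (M := M) ψ d hd
  refine ⟨.of fun i k => c.iBC ψ (b k) i, .of fun k j => b.repr (BaseChange.mk ψ (c.gen j)) k,
    ?_, ?_⟩
  · ext i j
    have h := congrFun (congrArg (c.iBC ψ) (b.sum_repr (BaseChange.mk ψ (c.gen j)))) i
    rw [map_sum, Finset.sum_apply, iBC_mk] at h
    refine Eq.trans ?_ h
    rw [Matrix.mul_apply]
    refine Finset.sum_congr rfl fun k _ => ?_
    rw [map_smul, Pi.smul_apply, smul_eq_mul, mul_comm]
    rfl
  · ext k l
    have h := congrArg (fun z => b.repr z k) (c.qBC_iBC ψ (b l))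
    simp only [qBC_apply, map_sum, map_smul, Finsupp.coe_finsetSum, Finset.sum_apply,
      Finsupp.smul_apply, smul_eq_mul, Module.Basis.repr_self] at h
    rw [Finsupp.single_apply] at h
    rw [Matrix.one_apply, Matrix.mul_apply]
    simp only [eq_comm (a := k), ← h]
    exact Finset.sum_congr rfl fun j _ => mul_comm _ _

end Coordinates

/-- Expand `det (B A) = 1` by multilinearity in the rows of `A`. Non-injective `γ` occur too and
contribute zero minors. -/
theorem sum_prod_mul_det_submatrix {S : Type*} [CommRing S] {n : Type*} [Fintype n] {d : ℕ}
    {A : Matrix n (Fin d) S} {B : Matrix (Fin d) n S} (h : B * A = 1) :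
    ∑ γ : Fin d → n, (∏ k, B k (γ k)) * (A.submatrix γ id).det = 1 := by
  classical
  rw [← Matrix.det_one (n := Fin d) (R := S), ← h]
  have h1 : B * A = fun k => ∑ j, B k j • A j := by
    ext k l
    simp [Matrix.mul_apply]
  have h2 := (Matrix.detRowAlternating (n := Fin d) (R := S)).toMultilinearMap.map_sum
    (fun k j => B k j • A j)
  rw [h1]
  refine Eq.trans ?_ h2.symm
  refine Finset.sum_congr rfl fun γ _ => ?_
  have h3 := (Matrix.detRowAlternating (n := Fin d) (R := S)).toMultilinearMap.map_smul_univ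
    (fun k => B k (γ k)) (fun k => A (γ k))
  exact h3.symm

/-- The index functions `Fin d ⊕ Fin c → t ⊕ l` which respect the summands. -/
def typedIndex (d c : ℕ) (t l : Type*) (α : (Fin d → t) × (Fin c → l)) :
    Fin d ⊕ Fin c → t ⊕ l := Sum.map α.1 α.2

/-- Minors respecting the two summands suffice: on block diagonal matrices they are products of
minors of the blocks. The restriction matters because only such minors are compatible with twists.
-/
theorem nonempty_splitting {S : Type*} [CommRing S] {t l : Type*} [Fintype t]
    [Fintype l] {d c : ℕ} {A₁ : Matrix t (Fin d) S} {B₁ : Matrix (Fin d) t S}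
    {A₂ : Matrix l (Fin c) S} {B₂ : Matrix (Fin c) l S} (h₁ : B₁ * A₁ = 1) (h₂ : B₂ * A₂ = 1) :
    Nonempty (Splitting (typedIndex d c t l) (Matrix.fromBlocks (A₁ * B₁) 0 0 (A₂ * B₂))) := by
  have t₁ : A₁.transpose * B₁.transpose = 1 := by rw [← Matrix.transpose_mul, h₁]; simp
  have t₂ : A₂.transpose * B₂.transpose = 1 := by rw [← Matrix.transpose_mul, h₂]; simp
  refine ⟨⟨Matrix.fromBlocks A₁ 0 0 A₂, Matrix.fromBlocks B₁ 0 0 B₂, ?_, ?_,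
    fun α => (∏ k, B₁ k (α.1 k)) * ∏ k, B₂ k (α.2 k),
    fun α => (∏ k, A₁ (α.1 k) k) * ∏ k, A₂ (α.2 k) k, ?_, ?_⟩⟩
  · simp [Matrix.fromBlocks_multiply]
  · simp [Matrix.fromBlocks_multiply, h₁, h₂]
  · have h := congrArg₂ (· * ·) (sum_prod_mul_det_submatrix h₁) (sum_prod_mul_det_submatrix h₂)
    rw [mul_one, Finset.sum_mul_sum, ← Fintype.sum_prod_type'] at h
    rw [← h]
    refine Finset.sum_congr rfl fun α _ => ?_
    have : (Matrix.fromBlocks A₁ 0 0 A₂).submatrix (typedIndex d c t l α) id =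
        Matrix.fromBlocks (A₁.submatrix α.1 id) 0 0 (A₂.submatrix α.2 id) := by
      ext (i | i) (j | j) <;> rfl
    rw [this, Matrix.det_fromBlocks_zero₂₁]
    ring
  · have h := congrArg₂ (· * ·) (sum_prod_mul_det_submatrix t₁) (sum_prod_mul_det_submatrix t₂)
    rw [mul_one, Finset.sum_mul_sum, ← Fintype.sum_prod_type'] at h
    rw [← h]
    refine Finset.sum_congr rfl fun α _ => ?_
    have : (Matrix.fromBlocks B₁ 0 0 B₂).submatrix id (typedIndex d c t l α) =
        Matrix.fromBlocks (B₁.submatrix id α.1) 0 0 (B₂.submatrix id α.2) := by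
      ext (i | i) (j | j) <;> rfl
    rw [this, Matrix.det_fromBlocks_zero₂₁, ← Matrix.det_transpose (B₁.submatrix _ _),
      ← Matrix.det_transpose (B₂.submatrix _ _), Matrix.transpose_submatrix,
      Matrix.transpose_submatrix]
    simp only [Matrix.transpose_apply]
    ring

/-- The basis of a base change of `M` given by a splitting of the idempotent matrix of `M`. -/
noncomputable def Coordinates.basisOfSplitting {n : Type*} [Fintype n] [DecidableEq n] {M : Type*}
    [AddCommGroup M] [Module W M] (c : Coordinates W n M) {S : Type u} [CommRing S] (ψ : W →+* S)
    {H 𝒜 : Type*} [Fintype H] [DecidableEq H] [Fintype 𝒜] {idx : 𝒜 → H → n}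
    (s : Splitting idx (c.E.map ψ)) : Module.Basis H S (BaseChange ψ M) :=
  Module.Basis.ofEquivFun
    { toFun := fun z => s.B.mulVec (c.iBC ψ z)
      map_add' := fun x y => by rw [map_add, Matrix.mulVec_add]
      map_smul' := fun a x => by rw [map_smul, Matrix.mulVec_smul, RingHom.id_apply]
      invFun := fun v => c.qBC ψ (s.A.mulVec v)
      left_inv := fun z => by
        beta_reduce
        rw [Matrix.mulVec_mulVec, s.mul_eq, ← c.iBC_qBC, c.qBC_iBC, c.qBC_iBC]
      right_inv := fun v => by
        beta_reduce
        rw [c.iBC_qBC, Matrix.mulVec_mulVec, Matrix.mulVec_mulVec, s.mul_E_mul, Matrix.one_mulVec] }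

end Coordinates

/-! ### Determinants and top exterior powers -/

section Exterior

variable {S : Type*} [CommRing S] {h : ℕ} {M M' N : Type*} [AddCommGroup M] [Module S M]
  [AddCommGroup M'] [Module S M'] [AddCommGroup N] [Module S N]

theorem alternatingMap_eq_det_smul (b : Module.Basis (Fin h) S M) (f : M [⋀^Fin h]→ₗ[S] N)
    (v : Fin h → M) : f v = b.det v • f b := by
  have : f = (LinearMap.toSpanSingleton S N (f b)).compAlternatingMap b.det := by
    refine Module.Basis.ext_alternating b fun σ hσ => ?_
    have hb : Function.Bijective σ := Finite.injective_iff_bijective.1 hσ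
    have h1 := f.map_perm b (Equiv.ofBijective σ hb)
    have h2 := b.det.map_perm b (Equiv.ofBijective σ hb)
    rw [b.det_self] at h2
    change f (b ∘ Equiv.ofBijective σ hb) = b.det (b ∘ Equiv.ofBijective σ hb) • f b
    rw [h1, h2]
    rcases Int.units_eq_one_or (Equiv.Perm.sign (Equiv.ofBijective σ hb)) with h3 | h3 <;>
      simp [h3]
  conv_lhs => rw [this]
  rfl

/-- The top exterior power is free of rank one and `g` acts on it by its determinant; this turns the
definition of `nuDet` into divisibility of a determinant. -/
theorem exteriorPower_map_dvd_iff (b : Module.Basis (Fin h) S M) (b' : Module.Basis (Fin h) S M')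
    (g : M →ₗ[S] M') (r : S) :
    (∀ ω, ∃ η, exteriorPower.map h g ω = r • η) ↔ r ∣ (LinearMap.toMatrix b b' g).det := by
  have hdet : b'.det (g ∘ b) = (LinearMap.toMatrix b b' g).det := by
    rw [Module.Basis.det_apply]
    congr 1
    ext i j
    rw [LinearMap.toMatrix_apply]
    rfl
  constructor
  · intro H
    obtain ⟨η, hη⟩ := H (exteriorPower.ιMulti S h b)
    rw [exteriorPower.map_apply_ιMulti] at hη
    refine ⟨exteriorPower.alternatingMapLinearEquiv b'.det η, ?_⟩
    rw [← smul_eq_mul, ← map_smul, ← hη, exteriorPower.alternatingMapLinearEquiv_apply_ιMulti, hdet]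
  · rintro ⟨t, ht⟩
    have key : exteriorPower.map h g = r • (LinearMap.toSpanSingleton S _
        (t • exteriorPower.ιMulti S h b')).comp
        (exteriorPower.alternatingMapLinearEquiv b.det) := by
      refine exteriorPower.linearMap_ext (AlternatingMap.ext fun v => ?_)
      change exteriorPower.map h g (exteriorPower.ιMulti S h v) =
        r • (exteriorPower.alternatingMapLinearEquiv b.det (exteriorPower.ιMulti S h v) •
          (t • exteriorPower.ιMulti S h b'))
      rw [exteriorPower.map_apply_ιMulti, exteriorPower.alternatingMapLinearEquiv_apply_ιMulti]
      have h1 := alternatingMap_eq_det_smul b ((exteriorPower.ιMulti S h).compLinearMap g) v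
      have h2 := alternatingMap_eq_det_smul b' (exteriorPower.ιMulti S h) (g ∘ b)
      refine h1.trans ?_
      change b.det v • exteriorPower.ιMulti S h (g ∘ b) = _
      rw [h2, hdet, ht, smul_comm r, mul_smul]
    exact fun ω => ⟨_, LinearMap.congr_fun key ω⟩

end Exterior


/-! ### Displays in matrix form -/

section Matrices

variable {p : ℕ} [hp : Fact p.Prime] {R : Type u} [CommRing R]

/-- The linear map `T ⊕ L → T' ⊕ L'` with given blocks. -/
noncomputable def blockMap {T L T' L' : Type*} [AddCommGroup T] [AddCommGroup L] [AddCommGroup T']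
    [AddCommGroup L'] [Module (WittVector p R) T] [Module (WittVector p R) L]
    [Module (WittVector p R) T'] [Module (WittVector p R) L']
    (a : T →ₗ[WittVector p R] T') (b : L →ₗ[WittVector p R] augIdeal p R ⊗[WittVector p R] T')
    (c : T →ₗ[WittVector p R] L') (d : L →ₗ[WittVector p R] L') :
    T × L →ₗ[WittVector p R] T' × L' :=
  (a.coprod (augMul.comp b)).prod (c.coprod d)

/-- The divided Frobenius twist `T^F ⊕ L^F → T'^F ⊕ L'^F`. -/
noncomputable def twistMap {T L T' L' : Type*} [AddCommGroup T] [AddCommGroup L] [AddCommGroup T']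
    [AddCommGroup L'] [Module (WittVector p R) T] [Module (WittVector p R) L]
    [Module (WittVector p R) T'] [Module (WittVector p R) L']
    (a : T →ₗ[WittVector p R] T') (b : L →ₗ[WittVector p R] augIdeal p R ⊗[WittVector p R] T')
    (c : T →ₗ[WittVector p R] L') (d : L →ₗ[WittVector p R] L') :
    BaseChange (F p R) T × BaseChange (F p R) L →ₗ[WittVector p R]
      BaseChange (F p R) T' × BaseChange (F p R) L' :=
  ((BaseChange.map (F p R) a).coprod (twistDiv b)).prod
    (((p : WittVector p R) • BaseChange.map (F p R) c).coprod (BaseChange.map (F p R) d))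

section Blocks

variable {T L T' L' : Type*} [AddCommGroup T] [AddCommGroup L] [AddCommGroup T']
  [AddCommGroup L'] [Module (WittVector p R) T] [Module (WittVector p R) L]
  [Module (WittVector p R) T'] [Module (WittVector p R) L'] {t l t' l' : Type*} [Fintype t]
  [Fintype l] [Fintype t'] [Fintype l'] [DecidableEq t] [DecidableEq l]
  [DecidableEq t'] [DecidableEq l'] (cT : Coordinates (WittVector p R) t T)
  (cL : Coordinates (WittVector p R) l L) (cT' : Coordinates (WittVector p R) t' T')
  (cL' : Coordinates (WittVector p R) l' L')
  (a : T →ₗ[WittVector p R] T') (b : L →ₗ[WittVector p R] augIdeal p R ⊗[WittVector p R] T')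
  (c : T →ₗ[WittVector p R] L') (d : L →ₗ[WittVector p R] L')

/-- On pure tensors: `V(F^div(x) F(n)) = x n`. -/
theorem verschiebung_iBC_FdivTensor (z : augIdeal p R ⊗[WittVector p R] T') (i : t') :
    verschiebung (cT'.iBC (F p R) (FdivTensor z) i) = cT'.i (augMul z) i := by
  induction z with
  | zero => simp
  | add x y hx hy => simp only [map_add, Pi.add_apply, hx, hy]
  | tmul x n =>
    change verschiebung (cT'.iBC (F p R) (Fdiv p R x • BaseChange.mk (F p R) n) i) =
      cT'.i ((x : WittVector p R) • n) i
    rw [map_smul, map_smul, Pi.smul_apply, Pi.smul_apply, Coordinates.iBC_mk, smul_eq_mul,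
      smul_eq_mul, verschiebung_mul_frobenius, verschiebung_Fdiv]

theorem mat_blockMap : Coordinates.mat (cT.prod cL) (cT'.prod cL') (blockMap a b c d) =
    Matrix.fromBlocks (cT.mat cT' a) (cL.mat cT' (augMul.comp b)) (cT.mat cL' c)
      (cL.mat cL' d) := by
  refine Matrix.ext fun i j => ?_
  rw [Coordinates.mat_apply]
  rcases j with j | j
  · rw [Coordinates.prod_gen_inl]
    rcases i with i | i
    · change cT'.i (a (cT.gen j) + augMul (b 0)) i = cT'.i (a (cT.gen j)) i
      rw [map_zero, map_zero, add_zero]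
    · change cL'.i (c (cT.gen j) + d 0) i = cL'.i (c (cT.gen j)) i
      rw [map_zero, add_zero]
  · rw [Coordinates.prod_gen_inr]
    rcases i with i | i
    · change cT'.i (a 0 + augMul (b (cL.gen j))) i = cT'.i (augMul (b (cL.gen j))) i
      rw [map_zero, zero_add]
    · change cL'.i (c 0 + d (cL.gen j)) i = cL'.i (d (cL.gen j)) i
      rw [map_zero, zero_add]

theorem map_mk {M M' : Type*} [AddCommGroup M] [AddCommGroup M'] [Module (WittVector p R) M]
    [Module (WittVector p R) M'] (f : M →ₗ[WittVector p R] M') (x : M) :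
    BaseChange.map (F p R) f (BaseChange.mk (F p R) x) = BaseChange.mk (F p R) (f x) :=
  BaseChange.map_tmul _ f 1 x

theorem isTwist_mat :
    IsTwist (Coordinates.mat (cT.prod cL) (cT'.prod cL') (blockMap a b c d))
      (Coordinates.mat ((cT.baseChange (F p R)).prod (cL.baseChange (F p R)))
        ((cT'.baseChange (F p R)).prod (cL'.baseChange (F p R))) (twistMap a b c d)) := by
  rw [mat_blockMap]
  constructor <;> intro i j <;> rw [Coordinates.mat_apply _ _ (twistMap a b c d)]
  · rw [Coordinates.prod_gen_inl, Coordinates.gen_baseChange]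
    change cT'.iBC (F p R) (BaseChange.map (F p R) a (BaseChange.mk (F p R) (cT.gen j)) +
      twistDiv b 0) i = _
    rw [map_zero, add_zero, map_mk, Coordinates.iBC_mk]
    rfl
  · rw [Coordinates.prod_gen_inr, Coordinates.gen_baseChange]
    change _ = verschiebung (cT'.iBC (F p R) (BaseChange.map (F p R) a 0 +
      twistDiv b (BaseChange.mk (F p R) (cL.gen j))) i)
    rw [map_zero, zero_add, twistDiv, BaseChange.linearize_mk]
    exact (verschiebung_iBC_FdivTensor cT' _ i).symm
  · rw [Coordinates.prod_gen_inl, Coordinates.gen_baseChange]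
    change cL'.iBC (F p R) ((p : WittVector p R) • BaseChange.map (F p R) c
      (BaseChange.mk (F p R) (cT.gen j)) + BaseChange.map (F p R) d 0) i = _
    rw [map_zero, add_zero, map_mk, map_smul, Pi.smul_apply, Coordinates.iBC_mk]
    rfl
  · rw [Coordinates.prod_gen_inr, Coordinates.gen_baseChange]
    change cL'.iBC (F p R) ((p : WittVector p R) • BaseChange.map (F p R) c 0 +
      BaseChange.map (F p R) d (BaseChange.mk (F p R) (cL.gen j))) i = _
    rw [map_zero, smul_zero, zero_add, map_mk, Coordinates.iBC_mk]
    rfl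

/-- A matrix with entries in the augmentation ideal defines a linear map `L → I ⊗ T'`. -/
noncomputable def augOfMat (G : Matrix t' l (WittVector p R)) (hG : ∀ i j, G i j ∈ augIdeal p R) :
    L →ₗ[WittVector p R] augIdeal p R ⊗[WittVector p R] T' :=
  (Fintype.linearCombination (WittVector p R) fun j =>
    ∑ i, (⟨G i j, hG i j⟩ : augIdeal p R) ⊗ₜ[WittVector p R] cT'.gen i).comp cL.i

theorem augMul_comp_augOfMat (G : Matrix t' l (WittVector p R))
    (hG : ∀ i j, G i j ∈ augIdeal p R) :
    augMul.comp (augOfMat cL cT' G hG) = cL.ofMat cT' G := by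
  ext x
  rw [LinearMap.comp_apply, augOfMat, LinearMap.comp_apply, Fintype.linearCombination_apply,
    map_sum]
  have h : ∀ v, cT'.q v = ∑ i, v i • cT'.gen i := fun v => by
    conv_lhs => rw [pi_eq_sum_univ' v, map_sum]
    exact Finset.sum_congr rfl fun i _ => by rw [map_smul]; rfl
  change _ = cT'.q (G.mulVec (cL.i x))
  rw [h]
  have h1 : ∀ j, augMul (∑ i, (⟨G i j, hG i j⟩ : augIdeal p R) ⊗ₜ[WittVector p R] cT'.gen i) =
      ∑ i, G i j • cT'.gen i := fun j => by
    rw [map_sum]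
    rfl
  have h2 : ∀ j, augMul (cL.i x j • ∑ i,
      (⟨G i j, hG i j⟩ : augIdeal p R) ⊗ₜ[WittVector p R] cT'.gen i) =
      ∑ i, (G i j * cL.i x j) • cT'.gen i := fun j => by
    rw [LinearMap.map_smul, h1, Finset.smul_sum]
    exact Finset.sum_congr rfl fun i _ => by rw [smul_smul, mul_comm]
  rw [Finset.sum_congr rfl fun j _ => h2 j, Finset.sum_comm]
  exact Finset.sum_congr rfl fun i _ => by rw [Matrix.mulVec, dotProduct, Finset.sum_smul]

end Blocks

/-- The upper right block is determined because `V` is injective. -/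
theorem IsTwist.eq {m n m' n' : Type*} {z y y' : Matrix (m ⊕ n) (m' ⊕ n') (WittVector p R)}
    (h : IsTwist z y) (h' : IsTwist z y') : y = y' := by
  ext1 i j
  rcases i with i | i <;> rcases j with j | j
  · rw [h.apply₁₁, h'.apply₁₁]
  · exact verschiebung_injective p R (by rw [← h.apply₁₂, h'.apply₁₂])
  · rw [h.apply₂₁, h'.apply₂₁]
  · rw [h.apply₂₂, h'.apply₂₂]

/-- The minors of typed index functions are compatible with twists. -/
theorem IsTwist.minors {t l t' l' : Type*} {d c : ℕ}
    {z y : Matrix (t' ⊕ l') (t ⊕ l) (WittVector p R)} (h : IsTwist z y)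
    (k : ((Fin d → t') × (Fin c → l')) × ((Fin d → t) × (Fin c → l))) :
    MatrixWindow.minors (typedIndex d c t' l') (typedIndex d c t l) y k =
      frobenius (MatrixWindow.minors (typedIndex d c t' l') (typedIndex d c t l) z k) :=
  (h.submatrix k.1.1 k.1.2 k.2.1 k.2.2).det_and_adjugate.1

/-- Twists are stable under sums, scalars, products and typed submatrices, and on square matrices
under adjugates; `adj` is built from these operations. -/
theorem IsTwist.adj {t l t' l' : Type*} [Fintype t] [Fintype l] [Fintype t'] [Fintype l']
    [DecidableEq t] [DecidableEq l] [DecidableEq t'] [DecidableEq l'] {d c : ℕ}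
    {z y : Matrix (t' ⊕ l') (t ⊕ l) (WittVector p R)} (h : IsTwist z y)
    {E : Matrix (t ⊕ l) (t ⊕ l) (WittVector p R)} {E' : Matrix (t' ⊕ l') (t' ⊕ l') (WittVector p R)}
    (hE : IsTwist E (E.map frobenius)) (hE' : IsTwist E' (E'.map frobenius))
    (η : ((Fin d → t') × (Fin c → l')) × ((Fin d → t) × (Fin c → l)) → WittVector p R) :
    IsTwist (MatrixWindow.adj (typedIndex d c t' l') (typedIndex d c t l) E E' η z)
      (MatrixWindow.adj (typedIndex d c t' l') (typedIndex d c t l) (E.map frobenius)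
        (E'.map frobenius) (frobenius ∘ η) y) := by
  refine IsTwist.sum _ fun k => IsTwist.smul _ (IsTwist.mul (IsTwist.mul ?_ ?_) ?_)
  · have := hE.submatrix id id k.2.1 k.2.2
    rwa [Sum.map_id_id] at this
  · exact (h.submatrix k.1.1 k.1.2 k.2.1 k.2.2).det_and_adjugate.2
  · have := hE'.submatrix k.1.1 k.1.2 id id
    rwa [Sum.map_id_id] at this

end Matrices

namespace MatrixWindow

variable {W : Type*} [CommRing W] {H N N' 𝒜 𝒜' : Type*} [Fintype H] [DecidableEq H] [Fintype N]
  [Fintype N'] [Fintype 𝒜] [Fintype 𝒜'] (idx : 𝒜 → H → N) (idx' : 𝒜' → H → N')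

theorem E_mul_adj {E : Matrix N N W} (E' : Matrix N' N' W) (η : 𝒜' × 𝒜 → W) (f : Matrix N' N W)
    (hE : E * E = E) : E * adj idx' idx E E' η f = adj idx' idx E E' η f := by
  rw [adj, Matrix.mul_sum]
  refine Finset.sum_congr rfl fun k _ => ?_
  have h : E * E.submatrix id (idx k.2) = E.submatrix id (idx k.2) := by
    conv_rhs => rw [← hE, Matrix.submatrix_mul _ _ _ id _ Function.bijective_id]
    rw [Matrix.submatrix_id_id]
  rw [Matrix.mul_smul, ← Matrix.mul_assoc, ← Matrix.mul_assoc, h]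

theorem adj_mul_E (E : Matrix N N W) {E' : Matrix N' N' W} (η : 𝒜' × 𝒜 → W) (f : Matrix N' N W)
    (hE : E' * E' = E') : adj idx' idx E E' η f * E' = adj idx' idx E E' η f := by
  rw [adj, Matrix.sum_mul]
  refine Finset.sum_congr rfl fun k _ => ?_
  have h : E'.submatrix (idx' k.1) id * E' = E'.submatrix (idx' k.1) id := by
    conv_rhs => rw [← hE, Matrix.submatrix_mul _ _ _ id _ Function.bijective_id]
    rw [Matrix.submatrix_id_id]
  rw [Matrix.smul_mul, Matrix.mul_assoc, h]

end MatrixWindow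

/-! ### Passage between displays and matrix windows. -/

namespace Display

variable {p : ℕ} [hp : Fact p.Prime] {R : Type u} [CommRing R]

section Window

variable (P P' : Display.{u, v} p R) {t l t' l' : Type*} [Fintype t] [Fintype l]
  [Fintype t'] [Fintype l'] [DecidableEq t] [DecidableEq l] [DecidableEq t'] [DecidableEq l']
  (cT : Coordinates (WittVector p R) t P.T) (cL : Coordinates (WittVector p R) l P.L)
  (cT' : Coordinates (WittVector p R) t' P'.T) (cL' : Coordinates (WittVector p R) l' P'.L)

theorem E_prod_baseChange :
    ((cT.baseChange (F p R)).prod (cL.baseChange (F p R))).E = (cT.prod cL).E.map (F p R) := by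
  rw [Coordinates.E_prod, Coordinates.E_prod, Coordinates.E_baseChange, Coordinates.E_baseChange,
    Matrix.fromBlocks_map, Matrix.map_zero _ (map_zero _), Matrix.map_zero _ (map_zero _)]

/-- The matrix form of a display. -/
noncomputable def window : MatrixWindow (F p R) (t ⊕ l) where
  E := (cT.prod cL).E
  Ψ := Coordinates.mat ((cT.baseChange (F p R)).prod (cL.baseChange (F p R))) (cT.prod cL)
    P.Ψ.toLinearMap
  Ψi := Coordinates.mat (cT.prod cL) ((cT.baseChange (F p R)).prod (cL.baseChange (F p R)))
    P.Ψ.symm.toLinearMap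
  Ψ_mul := by
    rw [← Coordinates.mat_comp, LinearEquiv.comp_symm]
    rfl
  Ψi_mul := by
    rw [← Coordinates.mat_comp, LinearEquiv.symm_comp, ← E_prod_baseChange]
    rfl
  E_mul_Ψ := Coordinates.E_mul_mat _ _ _
  Ψi_mul_E := Coordinates.mat_mul_E _ _ _

variable {P P'}

theorem Hom.comm' (f : P.Hom P') : P'.Ψ.toLinearMap ∘ₗ twistMap f.a f.b f.c f.d =
    f.toLinearMap ∘ₗ P.Ψ.toLinearMap :=
  LinearMap.ext fun z => f.comm z.1 z.2

theorem Hom.isHom (f : P.Hom P') : (window P cT cL).IsHom (window P' cT' cL')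
    (Coordinates.mat (cT.prod cL) (cT'.prod cL') f.toLinearMap)
    (Coordinates.mat ((cT.baseChange (F p R)).prod (cL.baseChange (F p R)))
        ((cT'.baseChange (F p R)).prod (cL'.baseChange (F p R)))
        (twistMap f.a f.b f.c f.d)) where
  E_mul := Coordinates.E_mul_mat _ _ _
  mul_E := Coordinates.mat_mul_E _ _ _
  E_mul' := by
    rw [window, ← E_prod_baseChange]
    exact Coordinates.E_mul_mat _ _ _
  mul_E' := by
    rw [window, ← E_prod_baseChange]
    exact Coordinates.mat_mul_E _ _ _
  comm := by
    rw [window, window, ← Coordinates.mat_comp, ← Coordinates.mat_comp, f.comm']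

theorem isSplit_window {d c : ℕ} (h : P.HasRank d c) :
    (window P cT cL).IsSplit (typedIndex d c t l) := by
  intro S _ _ ψ
  obtain ⟨A₁, B₁, h₁, h₁'⟩ := cT.exists_factorization ψ d h.1
  obtain ⟨A₂, B₂, h₂, h₂'⟩ := cL.exists_factorization ψ c h.2
  have h3 : (window P cT cL).E.map ψ = Matrix.fromBlocks (A₁ * B₁) 0 0 (A₂ * B₂) := by
    change (cT.prod cL).E.map ψ = _
    rw [Coordinates.E_prod, h₁, h₂, Matrix.fromBlocks_map, Matrix.map_zero _ (map_zero _),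
      Matrix.map_zero _ (map_zero _)]
  rw [h3]
  exact nonempty_splitting h₁' h₂'

/-- A matrix `G` with twist `G'` which commutes with `Ψ` comes from a morphism of displays. -/
theorem exists_hom {G G' : Matrix (t' ⊕ l') (t ⊕ l) (WittVector p R)} (hG : IsTwist G G')
    (h' : (cT'.prod cL').E * G = G) (h : G * (cT.prod cL).E = G)
    (hΨ : (window P' cT' cL').Ψ * G' = G * (window P cT cL).Ψ) :
    ∃ g : P.Hom P', Coordinates.mat (cT.prod cL) (cT'.prod cL') g.toLinearMap = G := by
  have haug : ∀ i j, G.toBlocks₁₂ i j ∈ augIdeal p R := fun i j => by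
    change (G (.inl i) (.inr j)).coeff 0 = 0
    rw [hG.apply₁₂, verschiebung_coeff_zero]
  set a := cT.ofMat cT' G.toBlocks₁₁
  set b := augOfMat cL cT' G.toBlocks₁₂ haug
  set c := cT.ofMat cL' G.toBlocks₂₁
  set d := cL.ofMat cL' G.toBlocks₂₂
  have hmat : Coordinates.mat (cT.prod cL) (cT'.prod cL') (blockMap a b c d) = G := by
    rw [mat_blockMap, augMul_comp_augOfMat, Coordinates.mat_ofMat, Coordinates.mat_ofMat,
      Coordinates.mat_ofMat, Coordinates.mat_ofMat]
    have h1 : (cT'.prod cL').E * G * (cT.prod cL).E = G := by rw [h', h]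
    conv_rhs => rw [← h1, ← Matrix.fromBlocks_toBlocks G, Coordinates.E_prod, Coordinates.E_prod,
      Matrix.fromBlocks_multiply, Matrix.fromBlocks_multiply]
    simp
  -- The matrix of the twisted map and `G'` are both twists of `G`, hence equal.
  have htw : Coordinates.mat ((cT.baseChange (F p R)).prod (cL.baseChange (F p R)))
      ((cT'.baseChange (F p R)).prod (cL'.baseChange (F p R))) (twistMap a b c d) = G' := by
    have := isTwist_mat cT cL cT' cL' a b c d
    rw [hmat] at this
    exact this.eq hG
  have hcomm : P'.Ψ.toLinearMap ∘ₗ twistMap a b c d = blockMap a b c d ∘ₗ P.Ψ.toLinearMap := by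
    apply Coordinates.mat_injective ((cT.baseChange (F p R)).prod (cL.baseChange (F p R)))
      (cT'.prod cL')
    rw [Coordinates.mat_comp _ ((cT'.baseChange (F p R)).prod (cL'.baseChange (F p R))),
      Coordinates.mat_comp _ (cT.prod cL), hmat, htw]
    exact hΨ
  exact ⟨⟨a, b, c, d, fun x y => LinearMap.congr_fun hcomm (x, y)⟩, hmat⟩

end Window

end Display


/-! ### The height of an isogeny in matrix form -/

theorem Coordinates.toMatrix_basisOfSplitting {W : Type u} [CommRing W] {n n' : Type*} [Fintype n]
    [DecidableEq n] [Fintype n'] [DecidableEq n'] {M M' : Type*} [AddCommGroup M] [Module W M]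
    [AddCommGroup M'] [Module W M'] (c : Coordinates W n M) (c' : Coordinates W n' M')
    {S : Type u} [CommRing S] (ψ : W →+* S) {H 𝒜 𝒜' : Type*} [Fintype H] [DecidableEq H]
    [Fintype 𝒜] [Fintype 𝒜'] {idx : 𝒜 → H → n} {idx' : 𝒜' → H → n'}
    (s : Splitting idx (c.E.map ψ)) (s' : Splitting idx' (c'.E.map ψ)) (f : M →ₗ[W] M') :
    LinearMap.toMatrix (c.basisOfSplitting ψ s) (c'.basisOfSplitting ψ s')
      (BaseChange.map ψ f) = s'.B * (c.mat c' f).map ψ * s.A := by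
  refine Matrix.ext fun k l => ?_
  rw [LinearMap.toMatrix_apply]
  have h1 : c.basisOfSplitting ψ s l = c.qBC ψ (s.A.mulVec (Pi.single l 1)) := by
    simp only [basisOfSplitting, Module.Basis.coe_ofEquivFun]
    rfl
  have h2 : ∀ z, (c'.basisOfSplitting ψ s').repr z k = s'.B.mulVec (c'.iBC ψ z) k := fun z => rfl
  rw [h1, h2, c.iBC_map c' ψ f, c.iBC_qBC, Matrix.mulVec_mulVec, Matrix.mulVec_mulVec,
    Matrix.mulVec_mulVec, Matrix.mulVec_single_one, Matrix.mul_assoc, Matrix.mul_assoc, s.E_mul_A,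
    ← Matrix.mul_assoc]
  rfl

theorem pow_dvd_of_iSup_eq {S : Type*} [CommRing S] (q x : S) (m : ℕ)
    (h : ⨆ (n : ℕ) (_ : q ^ n ∣ x), (n : ℕ∞) = m) : q ^ m ∣ x ∧ ¬ q ^ (m + 1) ∣ x := by
  constructor
  · by_contra hm
    -- For `m = 0` the truncated bound `m - 1` gives no contradiction, but then `q ^ 0` divides
    -- everything.
    have hle : ⨆ (n : ℕ) (_ : q ^ n ∣ x), (n : ℕ∞) ≤ ((m - 1 : ℕ) : ℕ∞) := by
      refine iSup₂_le fun n hn => ?_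
      have hlt : n < m := by
        by_contra hnm
        exact hm ((pow_dvd_pow q (not_lt.1 hnm)).trans hn)
      exact_mod_cast Nat.le_pred_of_lt hlt
    rw [h] at hle
    have h0 : m ≤ m - 1 := by exact_mod_cast hle
    obtain rfl : m = 0 := by omega
    exact hm (by simp)
  · intro hm
    have hle : ((m + 1 : ℕ) : ℕ∞) ≤ ⨆ (n : ℕ) (_ : q ^ n ∣ x), (n : ℕ∞) :=
      le_iSup₂_of_le (m + 1) hm le_rfl
    rw [h] at hle
    have h0 : m + 1 ≤ m := by exact_mod_cast hle
    omega

section Height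

variable {p : ℕ} [hp : Fact p.Prime] {R : Type u} [CommRing R]

theorem charP_geomPoint (hR : IsNilpotent (p : R)) (x : PrimeSpectrum R) :
    CharP (AlgebraicClosure x.asIdeal.ResidueField) p := by
  have h : ((p : ℕ) : AlgebraicClosure x.asIdeal.ResidueField) = 0 := by
    have := (hR.map (Hom.toGeomPoint x)).eq_zero
    rwa [map_natCast] at this
  obtain ⟨q, hq⟩ := CharP.exists (AlgebraicClosure x.asIdeal.ResidueField)
  have hd : q ∣ p := (CharP.cast_eq_zero_iff _ q p).1 h
  rcases (Nat.dvd_prime hp.out).1 hd with h1 | h1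
  · subst h1
    exact absurd (CharP.CharOne.subsingleton (R := AlgebraicClosure x.asIdeal.ResidueField))
      (not_subsingleton _)
  · exact h1 ▸ hq

theorem toGeomPoint_eq_zero_iff (x : PrimeSpectrum R) (r : R) :
    Hom.toGeomPoint x r = 0 ↔ r ∈ x.asIdeal := by
  rw [Hom.toGeomPoint, RingHom.comp_apply, map_eq_zero, Ideal.algebraMap_residueField_eq_zero]

variable {P P' : Display.{u, v} p R} {t l t' l' : Type} [Fintype t] [Fintype l]
  [Fintype t'] [Fintype l'] [DecidableEq t] [DecidableEq l] [DecidableEq t'] [DecidableEq l']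
  (cT : Coordinates (WittVector p R) t P.T) (cL : Coordinates (WittVector p R) l P.L)
  (cT' : Coordinates (WittVector p R) t' P'.T) (cL' : Coordinates (WittVector p R) l' P'.L)

theorem pow_dvd_of_nuDet_eq (hR : IsNilpotent (p : R)) (f : P.Hom P') {H 𝒜 𝒜' : Type*} [Fintype H]
    [DecidableEq H] [Fintype 𝒜] [Fintype 𝒜'] {idx : 𝒜 → H → t ⊕ l} {idx' : 𝒜' → H → t' ⊕ l'}
    (x : PrimeSpectrum R) (m : ℕ) (hm : f.nuDet x = m)
    (s : Splitting idx ((cT.prod cL).E.map (WittVector.map (p := p) (Hom.toGeomPoint x))))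
    (s' : Splitting idx' ((cT'.prod cL').E.map (WittVector.map (p := p) (Hom.toGeomPoint x)))) :
    (p : WittVector p (AlgebraicClosure x.asIdeal.ResidueField)) ^ m ∣
        (s'.B * (Coordinates.mat (cT.prod cL) (cT'.prod cL') f.toLinearMap).map
          (WittVector.map (Hom.toGeomPoint x)) * s.A).det ∧
      ¬ (p : WittVector p (AlgebraicClosure x.asIdeal.ResidueField)) ^ (m + 1) ∣
        (s'.B * (Coordinates.mat (cT.prod cL) (cT'.prod cL') f.toLinearMap).map
          (WittVector.map (Hom.toGeomPoint x)) * s.A).det := by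
  have := charP_geomPoint hR x
  set b := (cT.prod cL).basisOfSplitting (WittVector.map (p := p) (Hom.toGeomPoint x)) s
  set b' := (cT'.prod cL').basisOfSplitting (WittVector.map (p := p) (Hom.toGeomPoint x)) s'
  have hfin := Module.finrank_eq_card_basis b
  -- Exterior powers are indexed by `Fin h`, so the bases are reindexed; the determinant is
  -- unchanged.
  let e := Fintype.equivFinOfCardEq hfin.symm
  refine pow_dvd_of_iSup_eq _ _ m ?_
  rw [← Coordinates.toMatrix_basisOfSplitting]
  have hdet : (LinearMap.toMatrix b b' (BaseChange.map (WittVector.map (p := p)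
      (Hom.toGeomPoint x)) f.toLinearMap)).det =
      (LinearMap.toMatrix (b.reindex e) (b'.reindex e) (BaseChange.map (WittVector.map (p := p)
      (Hom.toGeomPoint x)) f.toLinearMap)).det := by
    rw [← Matrix.det_submatrix_equiv_self e.symm]
    congr 1
    ext i j : 2
    rw [Matrix.submatrix_apply, LinearMap.toMatrix_apply, LinearMap.toMatrix_apply]
    simp
  change ⨆ (n : ℕ) (_ : _ ∣ (LinearMap.toMatrix b b' _).det), (n : ℕ∞) = m
  rw [hdet, ← hm]
  simp only [← exteriorPower_map_dvd_iff]
  rfl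

/-- The minors of `f` at a geometric point are divisible by exactly `p ^ m`. -/
theorem pow_dvd_minors (hR : IsNilpotent (p : R)) (f : P.Hom P') {d c : ℕ} (h : P.HasRank d c)
    (h' : P'.HasRank d c) (x : PrimeSpectrum R) (m : ℕ) (hm : f.nuDet x = m) :
    letI δ := fun k => WittVector.map (Hom.toGeomPoint x) (MatrixWindow.minors
      (typedIndex d c t' l') (typedIndex d c t l)
      (Coordinates.mat (cT.prod cL) (cT'.prod cL') f.toLinearMap) k)
    (∀ k, (p : WittVector p (AlgebraicClosure x.asIdeal.ResidueField)) ^ m ∣ δ k) ∧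
      ¬ ∀ k, (p : WittVector p (AlgebraicClosure x.asIdeal.ResidueField)) ^ (m + 1) ∣ δ k := by
  have := charP_geomPoint hR x
  have := IsAlgClosed.perfectRing (AlgebraicClosure x.asIdeal.ResidueField) p
  obtain ⟨s⟩ := isSplit_window cT cL h _ (WittVector.map (p := p) (Hom.toGeomPoint x))
  obtain ⟨s'⟩ := isSplit_window cT' cL' h' _ (WittVector.map (p := p) (Hom.toGeomPoint x))
  obtain ⟨h1, h2⟩ := pow_dvd_of_nuDet_eq cT cL cT' cL' hR f x m hm s s'
  have hf := f.isHom cT cL cT' cL'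
  have key : ∀ k, WittVector.map (Hom.toGeomPoint x) (MatrixWindow.minors
      (typedIndex d c t' l') (typedIndex d c t l)
      (Coordinates.mat (cT.prod cL) (cT'.prod cL') f.toLinearMap) k) =
      Splitting.θ s' s k * (s'.B * (Coordinates.mat (cT.prod cL) (cT'.prod cL')
        f.toLinearMap).map (WittVector.map (Hom.toGeomPoint x)) * s.A).det := fun k => by
    rw [MatrixWindow.minors, MatrixWindow.map_det_submatrix, s'.det_submatrix s _
      (MatrixWindow.map_mul_eq _ hf.E_mul) (MatrixWindow.map_mul_eq' _ hf.mul_E), Splitting.θ]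
    ring
  simp only [key]
  refine ⟨fun k => h1.mul_left _, fun h3 => h2 ?_⟩
  obtain ⟨a, ha⟩ := Splitting.sum_θ s' s
  rw [← one_mul (Matrix.det _), ← ha, Finset.sum_mul]
  exact Finset.dvd_sum fun k _ => by
    rw [mul_assoc]
    exact (h3 k).mul_left _

theorem coeff_eq_zero_of_pow_dvd {k : Type*} [CommRing k] [CharP k p] {m : ℕ} {y : WittVector p k}
    (h : (p : WittVector p k) ^ m ∣ y) {i : ℕ} (hi : i < m) : y.coeff i = 0 := by
  obtain ⟨z, rfl⟩ := h
  rw [mul_comm, mul_pow_charP_coeff_zero z hi]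

/-- In characteristic `p` one has `V F = p`, and `F` is surjective over a perfect ring, so the image
of `V` consists of multiples of `p`. -/
theorem dvd_of_coeff_zero_eq_zero {k : Type*} [CommRing k] [CharP k p] [PerfectRing k p]
    {y : WittVector p k} (h : y.coeff 0 = 0) : (p : WittVector p k) ∣ y := by
  obtain ⟨z, hz⟩ := (frobenius_bijective p k).surjective (y.shift 1)
  refine ⟨z, ?_⟩
  refine (verschiebung_shift_one ⟨y, h⟩).symm.trans ?_
  change verschiebung (y.shift 1) = _
  rw [← hz, verschiebung_frobenius, mul_comm]

/-- An isogeny `f` of height `m` has a morphism `g` with `g ∘ f = p ^ m`. -/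
theorem exists_hom_comp_eq (hR : IsNilpotent (p : R)) (f : P.Hom P') {d c : ℕ} (h : P.HasRank d c)
    (h' : P'.HasRank d c) (m : ℕ) (hm : f.HasHeight m) (cT : Coordinates (WittVector p R) t P.T)
    (cL : Coordinates (WittVector p R) l P.L) (cT' : Coordinates (WittVector p R) t' P'.T)
    (cL' : Coordinates (WittVector p R) l' P'.L) :
    ∃ g : P'.Hom P, ∀ x, g.toLinearMap (f.toLinearMap x) = (p : WittVector p R) ^ m • x := by
  classical
  obtain ⟨N, hN⟩ := hR
  have hw := isSplit_window cT cL h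
  have hw' := isSplit_window cT' cL' h'
  have hf := f.isHom cT cL cT' cL'
  have htw := isTwist_mat cT cL cT' cL' f.a f.b f.c f.d
  set fm := Coordinates.mat (cT.prod cL) (cT'.prod cL') f.toLinearMap
  set δ := MatrixWindow.minors (typedIndex d c t' l') (typedIndex d c t l) fm with hδ
  have hmin := fun x => pow_dvd_minors cT cL cT' cL' ⟨N, hN⟩ f h h' x m (hm x)
  obtain ⟨u, hδu, hu⟩ := exists_eq_pow_smul hN (MatrixWindow.transition hw' hw) δ
    (hf.minors_eq hw' hw fun k => htw.minors k) m fun k i hi => by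
      -- Nilpotence is tested at geometric points. There `p ^ m` divides the minors, and in
      -- characteristic `p` this kills the first `m` components.
      rw [nilpotent_iff_mem_prime]
      intro J hJ
      have := charP_geomPoint ⟨N, hN⟩ ⟨J, hJ⟩
      rw [← toGeomPoint_eq_zero_iff ⟨J, hJ⟩, ← WittVector.map_coeff]
      exact coeff_eq_zero_of_pow_dvd ((hmin ⟨J, hJ⟩).1 k) hi
  -- If all leading components of `u` vanished at `J`, then `p` would divide `u` at the geometric
  -- point, and `p ^ (m + 1)` would divide all minors there.
  obtain ⟨r, hr⟩ := MatrixWindow.exists_sum_mul_eq_one (fun k => (u k).coeff 0) fun J _ hJ => by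
    have hJp : J.IsPrime := inferInstance
    have := charP_geomPoint ⟨N, hN⟩ ⟨J, hJp⟩
    have := IsAlgClosed.perfectRing (AlgebraicClosure (PrimeSpectrum.mk J hJp).asIdeal.ResidueField) p
    refine (hmin ⟨J, hJp⟩).2 fun k => ?_
    change _ ∣ WittVector.map _ (δ k)
    rw [hδu k, map_mul, map_pow, map_natCast, pow_succ]
    refine mul_dvd_mul_left _ (dvd_of_coeff_zero_eq_zero ?_)
    rw [WittVector.map_coeff, toGeomPoint_eq_zero_iff, ← Ideal.Quotient.eq_zero_iff_mem]
    exact hJ k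
  have hunit : IsUnit (frobIter p R N (∑ k, teichmuller p (r k) * u k)) := by
    refine isUnit_frobIter hN _ ?_
    change constantCoeff _ = 1
    rw [map_sum, ← hr]
    refine Finset.sum_congr rfl fun k _ => ?_
    rw [map_mul]
    exact congrArg (· * _) (teichmuller_coeff_zero p (r k))
  obtain ⟨η, hη⟩ := MatrixWindow.exists_sum_mul_eq_one u fun 𝔮 _ h𝔮 => by
    have := MatrixWindow.isLocalRing_quotient 𝔮
    -- If `u` vanishes at `𝔮`, so do all its Frobenius iterates: apply `map_frob_eq_zero` to the
    -- composite of `F^n` with reduction modulo `𝔮`. This uses splittings along arbitrary maps to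
    -- local rings.
    have hiter : ∀ n k, Ideal.Quotient.mk 𝔮 (frobIter p R n (u k)) = 0 := by
      intro n
      induction n with
      | zero => exact h𝔮
      | succ n ih =>
        intro k
        rw [frobIter_succ_apply, ← frobIter_frobenius]
        exact MatrixWindow.map_frob_eq_zero hw' hw u hu
          ((Ideal.Quotient.mk 𝔮).comp (frobIter p R n)) ih k
    have h0 : Ideal.Quotient.mk 𝔮 (frobIter p R N (∑ k, teichmuller p (r k) * u k)) = 0 := by
      rw [map_sum, map_sum]
      exact Finset.sum_eq_zero fun k _ => by rw [map_mul, map_mul, hiter, mul_zero]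
    exact not_isUnit_zero (h0 ▸ hunit.map (Ideal.Quotient.mk 𝔮))
  -- The matrix `adj` for this `η` is the wanted `g`; it commutes with `Ψ`, and its product with `f`
  -- is `p ^ m` times the idempotent `E`.
  obtain ⟨hΨ, hcomp⟩ := hf.adj_comm_and_adj_mul hw' hw ((p : WittVector p R) ^ m) u hu hδu η hη
  have hE : (cT.prod cL).E * (cT.prod cL).E = (cT.prod cL).E := Coordinates.mat_mul_E _ _ _
  have hE' : (cT'.prod cL').E * (cT'.prod cL').E = (cT'.prod cL').E := Coordinates.mat_mul_E _ _ _
  obtain ⟨g, hg⟩ := exists_hom cT' cL' cT cL (htw.adj (by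
      rw [Coordinates.E_prod]; exact IsTwist.fromBlocks_diagonal _ _) (by
      rw [Coordinates.E_prod]; exact IsTwist.fromBlocks_diagonal _ _) η)
    (MatrixWindow.E_mul_adj _ _ _ η _ hE) (MatrixWindow.adj_mul_E _ _ _ η _ hE') hΨ
  refine ⟨g, fun x => ?_⟩
  have hgf : g.toLinearMap ∘ₗ f.toLinearMap = (p : WittVector p R) ^ m • LinearMap.id := by
    apply Coordinates.mat_injective (cT.prod cL) (cT.prod cL)
    rw [Coordinates.mat_comp _ (cT'.prod cL'), hg]
    refine hcomp.trans ?_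
    refine Matrix.ext fun i j => ?_
    change (p : WittVector p R) ^ m * (cT.prod cL).i _ i =
      (cT.prod cL).i ((p : WittVector p R) ^ m • (cT.prod cL).gen j) i
    rw [map_smul]
    rfl
  exact LinearMap.congr_fun hgf x

end Height

end WittDisplay

/-! ### The theorem: passage to iso-displays. -/

open WittDisplay Display in
theorem mainTheorem9 (p : ℕ) [Fact p.Prime] (R : Type u) [CommRing R] (hR : IsNilpotent (p : R))
    (P P' : WittDisplay.Display.{u, v} p R) (hP : P.IsNilpotent) (hP' : P'.IsNilpotent)
    (f : P.Hom P') (hf : f.IsIsogeny) (m : ℕ) (hm : f.HasHeight m) :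
    (hf.quasiIsogeny.symm.pPowSMul m).IsIsogeny := by
  obtain ⟨d, c, h, h'⟩ := hf.hasRank
  obtain ⟨t, ⟨cT⟩⟩ := Coordinates.exists_of_projective (W := WittVector p R) P.T
  obtain ⟨l, ⟨cL⟩⟩ := Coordinates.exists_of_projective (W := WittVector p R) P.L
  obtain ⟨t', ⟨cT'⟩⟩ := Coordinates.exists_of_projective (W := WittVector p R) P'.T
  obtain ⟨l', ⟨cL'⟩⟩ := Coordinates.exists_of_projective (W := WittVector p R) P'.L
  obtain ⟨g, hg⟩ := exists_hom_comp_eq hR f h h' m hm cT cL cT' cL'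
  have key : (hf.quasiIsogeny.symm.pPowSMul m).toQuasiHom = g.toQuasiHom := by
    refine Subtype.ext (LinearMap.ext fun y => ?_)
    -- After inverting `p`, `f` is surjective, so the two maps need only be compared on its image,
    -- where both give `p ^ m • x`.
    obtain ⟨x, rfl⟩ := hf.quasiIsogeny.1.surjective y
    have h1 : hf.quasiIsogeny.1 x =
        BaseChange.map (algebraMap (WittVector p R) (WQ p R)) f.toLinearMap x :=
      LinearMap.congr_fun (congrArg Subtype.val hf.quasiIsogeny_toQuasiHom) x
    have h2 : (hf.quasiIsogeny.symm.pPowSMul m).1 (hf.quasiIsogeny.1 x) = (p ^ m : WQ p R) • x :=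
      (QuasiIsogeny.pPowSMul_apply m _ _).trans
        (congrArg _ (hf.quasiIsogeny.1.symm_apply_apply x))
    refine h2.trans ?_
    change _ = BaseChange.map (algebraMap (WittVector p R) (WQ p R)) g.toLinearMap _
    rw [h1]
    clear h1 h2
    induction x using BaseChange.induction with
    | zero => simp only [map_zero, smul_zero]
    | add x y hx hy => rw [smul_add, hx, hy, map_add, map_add]
    | tmul b x =>
      rw [BaseChange.map_tmul, BaseChange.map_tmul, hg, BaseChange.tmul_smul, BaseChange.smul_tmul,
        map_pow, map_natCast]
  -- The isomorphism showing that `g` is an isogeny is `p ^ m f⁻¹` itself.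
  exact ⟨g, ⟨⟨d, c, h', h⟩, _, key⟩, key.symm⟩
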